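/- Let $K\ge 1$, let $\triangle^K=\{z\in[0,1]^K:\sum_k z_k=1\}$ be the $(K-1)$-dimensional probability simplex, let $(\Omega,\mathcal A,\mathbb P)$ be a probability space, $\mathcal X$ a measurable space (for instance $\mathbb R^m$), $x:\Omega\to\mathcal X$ an input, $y$ a class label with $K$ possible values, identified with its one-hot encoding in $\{e_1,\dots,e_K\}\subset\triangle^K$, and $f:\mathcal X\to\triangle^K$ a measurable model. Let $(x_i,y_i)_{i\ge 1}$ be independent copies of $(x,y)$ on $\Omega$. For $h>0$ and $z,w\in\triangle^K$ define the Dirichlet kernel $$k_{\mathrm{Dir}}^{h}(z;w)=\frac{\Gamma\left(\sum_{k=1}^K\alpha_k\right)}{\prod_{k=1}^K\Gamma(\alpha_k)}\prod_{k=1}^K z_k^{\alpha_k-1},\qquad \alpha_k=\frac{w_k}{h}+1 .$$ Assume that $f(x)$ has a density with respect to Lebesgue measure on $\triangle^K$ (in the first $K-1$ coordinates) which is Lipschitz continuous on the interior of the simplex, and let the bandwidths $h_n>0$ satisfy $h_n\to0$ and $n\,h_n^{(K-1)/2}\to\infty$ as $n\to\infty$. Then for every real $p\ge1$ the random variable $\bigl\|\mathbb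 E[y\mid f(x)]-f(x)\bigr\|_p^p$ is integrable, and the leave-one-out Dirichlet kernel estimator of the ($p$-th power of the) canonical $L_p$ calibration error is consistent: in probability, as $n\to\infty$, $$\frac1n\sum_{j=1}^n\left\|\frac{\sum_{i\le n,\,i\ne j}k_{\mathrm{Dir}}^{h_n}(f(x_j);f(x_i))\,y_i}{\sum_{i\le n,\,i\ne j}k_{\mathrm{Dir}}^{h_n}(f(x_j);f(x_i))}-f(x_j)\right\|_p^p\;\longrightarrow\;\mathbb E\Bigl[\bigl\|\mathbb E[y\mid f(x)]-f(x)\bigr\|_p^p\Bigr].$$ -/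

import Mathlib

open MeasureTheory ProbabilityTheory Filter Topology
open scoped NNReal ENNReal

noncomputable section

/-- The (relative) interior of the simplex with `d + 1` vertices: all coordinates positive. -/
def openSimplex (d : ℕ) : Set (Fin (d + 1) → ℝ) :=
  {z | (∀ k, 0 < z k) ∧ ∑ k, z k = 1}

/-- The chart of the `d`-dimensional simplex by its first `d` coordinates,
`(s₁, …, s_d) ↦ (s₁, …, s_d, 1 - s₁ - ⋯ - s_d)`. -/
def simplexChart (d : ℕ) (s : Fin d → ℝ) : Fin (d + 1) → ℝ :=
  Fin.snoc (α := fun _ => ℝ) s (1 - ∑ i, s i)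

/-- Lebesgue measure on the `d`-dimensional simplex `stdSimplex ℝ (Fin (d + 1))`: the image, under
the chart, of Lebesgue measure on `{s ∈ ℝ^d | s_i ≥ 0, ∑ s_i ≤ 1}`. This is the reference measure
for the densities of Dirichlet distributions. -/
def simplexVolume (d : ℕ) : Measure (Fin (d + 1) → ℝ) :=
  ((volume : Measure (Fin d → ℝ)).restrict
    {s | (∀ i, 0 ≤ s i) ∧ ∑ i, s i ≤ 1}).map (simplexChart d)

/-- The chart is measurable, so that the image measure above is the genuine one. -/
theorem measurable_simplexChart (d : ℕ) : Measurable (simplexChart d) := by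
  refine measurable_pi_lambda _ fun k => ?_
  refine Fin.lastCases ?_ (fun i => ?_) k
  · simp only [simplexChart, Fin.snoc_last]
    fun_prop
  · simp only [simplexChart, Fin.snoc_castSucc]
    fun_prop

/-- The one-hot encoding of a class label: the vertex `e_k` of the simplex. -/
def oneHot {d : ℕ} (k : Fin (d + 1)) : Fin (d + 1) → ℝ :=
  Pi.single k 1

/-- `‖v‖_p ^ p`, with Mathlib's `ℓ^p` norm on a finite product. -/
def lpNormPow {d : ℕ} (p : ℝ) (v : Fin (d + 1) → ℝ) : ℝ :=
  ‖WithLp.toLp (ENNReal.ofReal p) v‖ ^ p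

/-- The Dirichlet kernel `k_Dir(z; w)` with bandwidth `h`: the density at `z` of the Dirichlet
distribution with parameters `α_k = w_k / h + 1`. -/
def dirichletKernel {d : ℕ} (h : ℝ) (z w : Fin (d + 1) → ℝ) : ℝ :=
  let α : Fin (d + 1) → ℝ := fun k => w k / h + 1
  Real.Gamma (∑ k, α k) / (∏ k, Real.Gamma (α k)) * ∏ k, z k ^ (α k - 1)

/-- The leave-one-out Dirichlet kernel estimate of `E[y | f(x)]` at `f(x) = z_j`, from the
predictions `z_i = f(x_i)` and labels `y_i`, `i < n`. -/
def looCondExpEstimate {d : ℕ} (h : ℝ) (n : ℕ) (z : ℕ → Fin (d + 1) → ℝ) (y : ℕ → Fin (d + 1))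
    (j : ℕ) : Fin (d + 1) → ℝ :=
  (∑ i ∈ (Finset.range n).erase j, dirichletKernel h (z j) (z i))⁻¹ •
    ∑ i ∈ (Finset.range n).erase j, dirichletKernel h (z j) (z i) • oneHot (y i)

/-- The Dirichlet kernel based estimator of the `p`-th power of the canonical `L_p` calibration
error, from the `n` predictions `z_i = f(x_i)` and labels `y_i`, `i < n`. -/
def ceEstimator {d : ℕ} (p h : ℝ) (n : ℕ) (z : ℕ → Fin (d + 1) → ℝ) (y : ℕ → Fin (d + 1)) : ℝ :=
  (1 / (n : ℝ)) * ∑ j ∈ Finset.range n, lpNormPow p (looCondExpEstimate h n z y j - z j)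

/-- The function `ω ↦ ‖E[y | f(x)] - f(x)‖_p ^ p` for the prediction `z = f(x)` and the (one-hot
encoded) label `y`; its expectation is the `p`-th power of the canonical `L_p` calibration error. -/
def calibrationGap {Ω : Type*} [MeasurableSpace Ω] {d : ℕ} (P : Measure Ω) (p : ℝ)
    (z : Ω → Fin (d + 1) → ℝ) (y : Ω → Fin (d + 1)) (ω : Ω) : ℝ :=
  lpNormPow p
    ((P[fun ω' => oneHot (y ω') | MeasurableSpace.comap z inferInstance]) ω - z ω)

end

/-! As a function of its second argument, the Dirichlet kernel is an unnormalised approximate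
identity of width `√h`. Only two-sided control of its mass is needed, because the normalisation
cancels in the estimator's ratio. By Stirling's formula, for interior `z` the kernel is `h ^ (-d /
2)` times an exponential whose leading term is `-1 / h` times the Kullback-Leibler divergence
between the Dirichlet mean and `z`. Bounding the divergence below by squared distance gives a
Gaussian upper bound (`exists_dirichletKernel_le`). Bounding it above by the chi-squared divergence
gives a lower bound of order `h ^ (-d / 2)` on the ball of radius `√h`
(`exists_le_dirichletKernel`). The law `ν` of the prediction gives balls of radius `r` mass `O(r ^
d)`, and mass at least `a * r ^ d` for small `r` around interior points of positive density. The
kernel's integral is therefore eventually pinched between positive constants at almost every `z`.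
The regression function `m` is only measurable, but almost every `z` is a Lebesgue point, so the
kernel-weighted oscillation of `m` vanishes there (`ae_tendsto_lintegral_dirichletKernel_mul`). At
such a `z`, the bias is controlled by this oscillation and the variance is `O(1 / (n * h ^ (d /
2)))`, since the kernel is at most of order `h ^ (-d / 2)` and has bounded mean
(`ae_eventually_integral_labelError_le`). Leaving out the `j`-th observation makes the evaluation
point independent of the sample, so the mean error is an integral over `ν` of errors at fixed
points, and dominated convergence applies (`tendsto_average_integral_labelError`). Finally, `t ^ p`
is Lipschitz on `[0, 1]`, so replacing the estimate by `m` costs an error that vanishes in mean.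
What remains is an empirical average governed by the strong law. -/

/-! ### Stirling bounds for the Gamma function. -/

/-- Stirling's approximation of `log n!`, up to a bounded error. -/
theorem abs_log_factorial_sub_le {n : ℕ} (hn : 1 ≤ n) :
    |Real.log (n.factorial : ℝ) - ((n + 1 / 2) * Real.log n - n)| ≤ 2 := by
  have hn0 : n ≠ 0 := by omega
  have hpos : (0 : ℝ) < n := by exact_mod_cast hn
  -- The Stirling sequence decreases to `√π`, so it lies between `√π` and its value `e / √2` at `1`.
  have h1 := Stirling.sqrt_pi_le_stirlingSeq hn0
  have h2 : Stirling.stirlingSeq n ≤ Real.exp 1 / √2 := by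
    have := Stirling.stirlingSeq'_antitone (Nat.zero_le (n - 1))
    simp only [Function.comp, Nat.succ_eq_add_one, zero_add, Stirling.stirlingSeq_one] at this
    rwa [Nat.sub_add_cancel hn] at this
  have h3 := Stirling.log_stirlingSeq_formula n
  have hlog : Real.log (n / Real.exp 1) = Real.log n - 1 := by
    rw [Real.log_div hpos.ne' (Real.exp_pos 1).ne', Real.log_exp]
  have hlog2 : Real.log (2 * n) = Real.log 2 + Real.log n :=
    Real.log_mul (by norm_num) hpos.ne'
  rw [hlog, hlog2] at h3
  have hsp : 0 < √Real.pi := Real.sqrt_pos.2 Real.pi_pos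
  have l1 : Real.log (√Real.pi) ≤ Real.log (Stirling.stirlingSeq n) := Real.log_le_log hsp h1
  have l2 : Real.log (Stirling.stirlingSeq n) ≤ Real.log (Real.exp 1 / √2) :=
    Real.log_le_log (hsp.trans_le h1) h2
  rw [Real.log_div (Real.exp_pos 1).ne' (by positivity), Real.log_exp,
    Real.log_sqrt (by norm_num)] at l2
  rw [Real.log_sqrt Real.pi_pos.le] at l1
  have l3 : 0 ≤ Real.log Real.pi := Real.log_nonneg (by linarith [Real.pi_gt_three])
  have l4 := Real.log_two_lt_d9
  have l5 := Real.log_two_gt_d9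
  rw [abs_le]
  constructor <;> nlinarith

/-- Stirling's approximation of `log Γ` on `[1, ∞)`, up to a bounded error. -/
theorem abs_log_Gamma_sub_le {s : ℝ} (hs : 1 ≤ s) :
    |Real.log (Real.Gamma s) - ((s - 1 / 2) * Real.log s - s)| ≤ 4 := by
  set n := ⌊s⌋₊ with hn
  have hn1 : 1 ≤ n := Nat.le_floor (by simpa using hs)
  have hns : (n : ℝ) ≤ s := Nat.floor_le (by linarith)
  have hsn : s < n + 1 := Nat.lt_floor_add_one s
  have hn1' : (1 : ℝ) ≤ n := by exact_mod_cast hn1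
  obtain ⟨t, ht⟩ : ∃ t, t = s - n := ⟨_, rfl⟩
  have ht0 : 0 ≤ t := by linarith
  have ht1 : t ≤ 1 := by linarith
  have hcv := Real.convexOn_log_Gamma
  have e1 : Real.log (Real.Gamma (n + 1)) = Real.log n + Real.log (Real.Gamma n) := by
    rw [Real.Gamma_add_one (by positivity), Real.log_mul (by positivity)
      (Real.Gamma_pos_of_pos (by positivity)).ne']
  have e2 : Real.log (Real.Gamma (s + 1)) = Real.log s + Real.log (Real.Gamma s) := by
    rw [Real.Gamma_add_one (by positivity), Real.log_mul (by positivity)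
      (Real.Gamma_pos_of_pos (by positivity)).ne']
  -- Log-convexity is used twice: `s` between `n` and `n + 1` bounds `log Γ(s)` above, and `n + 1`
  -- between `s` and `s + 1` bounds it below, in both cases by values at integers.
  have u1 := hcv.2 (show (n : ℝ) ∈ Set.Ioi 0 from Set.mem_Ioi.2 (by linarith))
    (show (n : ℝ) + 1 ∈ Set.Ioi 0 from Set.mem_Ioi.2 (by linarith))
    (show 0 ≤ 1 - t by linarith) ht0 (by ring)
  have u2 := hcv.2 (show s ∈ Set.Ioi 0 from Set.mem_Ioi.2 (by linarith))
    (show s + 1 ∈ Set.Ioi 0 from Set.mem_Ioi.2 (by linarith)) ht0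
    (show 0 ≤ 1 - t by linarith) (by ring)
  simp only [smul_eq_mul, Function.comp] at u1 u2
  rw [show (1 - t) * (n : ℝ) + t * (n + 1) = s by rw [ht]; ring] at u1
  rw [show t * s + (1 - t) * (s + 1) = (n : ℝ) + 1 by rw [ht]; ring] at u2
  have hf := abs_le.1 (abs_log_factorial_sub_le hn1)
  rw [← Real.Gamma_nat_eq_factorial] at hf
  have l1 : Real.log n ≤ Real.log s := Real.log_le_log (by linarith) hns
  have l2 : Real.log s - Real.log n ≤ t / n := by
    rw [← Real.log_div (by positivity) (by positivity)]
    refine (Real.log_le_sub_one_of_pos (by positivity)).trans (le_of_eq ?_)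
    rw [ht]; field_simp
  have l3 : (n + 1 / 2) * (Real.log s - Real.log n) ≤ 3 / 2 := by
    have h1 : (n + 1 / 2) * (Real.log s - Real.log n) ≤ (n + 1 / 2) * (t / n) := by gcongr
    have h2 : ((n : ℝ) + 1 / 2) * (t / n) ≤ 3 / 2 := by
      rw [← mul_div_assoc, div_le_iff₀ (by linarith)]
      nlinarith
    linarith
  have hs' : s = n + t := by linarith
  have l4 : 0 ≤ (n + t - 1 / 2) * (Real.log s - Real.log n) :=
    mul_nonneg (by linarith) (by linarith)
  generalize Real.log (Real.Gamma s) = a at *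
  generalize Real.log (Real.Gamma n) = b at *
  generalize Real.log (Real.Gamma (n + 1)) = c at *
  generalize Real.log (Real.Gamma (s + 1)) = e at *
  generalize Real.log s = ls at *
  generalize Real.log n = ln at *
  subst e1 e2
  rw [hs', abs_le]
  constructor <;> nlinarith

/-! ### Comparison of the Kullback-Leibler divergence with quadratic distances. -/

/-- Factor `a - b` through `√a + √b ≤ 2`. This passes from the Hellinger to the Euclidean distance.
-/
theorem sq_div_four_le_sub_sqrt_sq {a b : ℝ} (ha : 0 ≤ a) (hb : 0 ≤ b) (ha1 : a ≤ 1)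
    (hb1 : b ≤ 1) : (a - b) ^ 2 / 4 ≤ (√a - √b) ^ 2 := by
  have h1 : (a - b) = (√a - √b) * (√a + √b) := by
    nlinarith [Real.sq_sqrt ha, Real.sq_sqrt hb]
  have h2 : √a ≤ 1 := Real.sqrt_le_one.2 ha1
  have h3 : √b ≤ 1 := Real.sqrt_le_one.2 hb1
  have h4 : (√a + √b) ^ 2 ≤ 4 := by nlinarith [Real.sqrt_nonneg a, Real.sqrt_nonneg b]
  rw [h1, mul_pow]
  nlinarith [sq_nonneg (√a - √b)]

/-- The Kullback-Leibler divergence of two points of the simplex is at least a quarter of their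
squared distance. -/
theorem sum_sq_le_klDiv {ι : Type*} [Fintype ι] {v z : ι → ℝ} (hv : ∀ k, 0 < v k)
    (hz : ∀ k, 0 < z k) (hv1 : ∑ k, v k = 1) (hz1 : ∑ k, z k = 1) :
    (∑ k, (v k - z k) ^ 2) / 4 ≤ ∑ k, v k * (Real.log (v k) - Real.log (z k)) := by
  have le_one : ∀ u : ι → ℝ, (∀ k, 0 < u k) → ∑ k, u k = 1 → ∀ k, u k ≤ 1 := fun u hu h k =>
    h ▸ Finset.single_le_sum (fun i _ => (hu i).le) (Finset.mem_univ k)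
  -- Applying `log t ≤ t - 1` at `t = √(z k) / √(v k)` produces `(√(v k) - √(z k)) ^ 2 + (v k - z
  -- k)`; the linear terms sum to zero over `k`.
  have key : ∀ k, (v k - z k) ^ 2 / 4 + (v k - z k) ≤ v k * (Real.log (v k) - Real.log (z k)) := by
    intro k
    have h1 := sq_div_four_le_sub_sqrt_sq (hv k).le (hz k).le (le_one v hv hv1 k)
      (le_one z hz hz1 k)
    have sv := Real.sqrt_pos.2 (hv k)
    have sz := Real.sqrt_pos.2 (hz k)
    have h2 := Real.log_le_sub_one_of_pos (div_pos sz sv)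
    rw [Real.log_div sz.ne' sv.ne', Real.log_sqrt (hz k).le, Real.log_sqrt (hv k).le] at h2
    have h3 : v k * (Real.log (z k) / 2 - Real.log (v k) / 2) ≤ v k * (√(z k) / √(v k) - 1) :=
      mul_le_mul_of_nonneg_left h2 (hv k).le
    have h4 : v k * (√(z k) / √(v k) - 1) = √(v k) * √(z k) - v k := by
      have := Real.mul_self_sqrt (hv k).le
      field_simp
      nlinarith
    nlinarith [Real.sq_sqrt (hv k).le, Real.sq_sqrt (hz k).le]
  have := Finset.sum_le_sum fun k (_ : k ∈ Finset.univ) => key k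
  rw [Finset.sum_add_distrib, Finset.sum_sub_distrib, hv1, hz1, ← Finset.sum_div] at this
  linarith

/-- The Kullback-Leibler divergence of two points of the simplex is at most their chi-squared
divergence. -/
theorem klDiv_le_chiSq {ι : Type*} [Fintype ι] {v z : ι → ℝ} (hv : ∀ k, 0 < v k)
    (hz : ∀ k, 0 < z k) (hv1 : ∑ k, v k = 1) (hz1 : ∑ k, z k = 1) :
    ∑ k, v k * (Real.log (v k) - Real.log (z k)) ≤ ∑ k, (v k - z k) ^ 2 / z k := by
  -- Here `log t ≤ t - 1` is applied at `t = v k / z k`; again the linear terms cancel in the sum.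
  have key : ∀ k, v k * (Real.log (v k) - Real.log (z k)) ≤
      (v k - z k) ^ 2 / z k + (v k - z k) := by
    intro k
    have h2 := Real.log_le_sub_one_of_pos (div_pos (hv k) (hz k))
    rw [Real.log_div (hv k).ne' (hz k).ne'] at h2
    refine (mul_le_mul_of_nonneg_left h2 (hv k).le).trans (le_of_eq ?_)
    have := (hz k).ne'
    field_simp
    ring
  have := Finset.sum_le_sum fun k (_ : k ∈ Finset.univ) => key k
  rw [Finset.sum_add_distrib, Finset.sum_sub_distrib, hv1, hz1] at this
  linarith

/-! ### Gaussian bounds for the Dirichlet kernel. -/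

/-- Stirling's approximation of the Dirichlet density with parameters `A v_k`. -/
theorem abs_log_dirichlet_sub_le {d : ℕ} {A : ℝ} {v z : Fin (d + 1) → ℝ}
    (hA : 1 ≤ A) (hv : ∀ k, 1 ≤ A * v k) (hv1 : ∑ k, v k = 1) :
    |(Real.log (Real.Gamma A) - ∑ k, Real.log (Real.Gamma (A * v k))
        + ∑ k, (A * v k - 1) * Real.log (z k))
      - (d / 2 * Real.log A + ∑ k, (Real.log (v k) / 2 - Real.log (z k))
        - A * ∑ k, v k * (Real.log (v k) - Real.log (z k)))| ≤ 4 * (d + 2) := by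
  have hA0 : 0 < A := by linarith
  have hv0 : ∀ k, 0 < v k := fun k => by
    by_contra! h
    nlinarith [hv k]
  have h1 := abs_log_Gamma_sub_le hA
  have h2 : |∑ k, (Real.log (Real.Gamma (A * v k))
      - ((A * v k - 1 / 2) * Real.log (A * v k) - A * v k))| ≤ 4 * (d + 1) := by
    refine (Finset.abs_sum_le_sum_abs _ _).trans
      ((Finset.sum_le_sum fun k _ => abs_log_Gamma_sub_le (hv k)).trans (le_of_eq ?_))
    simp
    ring
  -- Since the `v k` sum to `1`, the terms `A * log A` and `A` cancel against `log Γ(A)`. The `d +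
  -- 1` halves of `log A`, less the one from `log Γ(A)`, leave `d / 2 * log A`.
  have h3 : ∀ k, (A * v k - 1 / 2) * Real.log (A * v k) - A * v k =
      (A * Real.log A - A) * v k - Real.log A / 2 + A * (v k * Real.log (v k))
        - Real.log (v k) / 2 := fun k => by
    rw [Real.log_mul hA0.ne' (hv0 k).ne']; ring
  simp only [h3, Finset.sum_sub_distrib, Finset.sum_add_distrib, ← Finset.mul_sum, hv1,
    Finset.sum_const, Finset.card_univ, Fintype.card_fin, nsmul_eq_mul, Nat.cast_add,
    Nat.cast_one] at h2
  have h4 : ∑ k, (A * v k - 1) * Real.log (z k) =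
      A * ∑ k, v k * Real.log (z k) - ∑ k, Real.log (z k) := by
    rw [Finset.mul_sum, ← Finset.sum_sub_distrib]
    exact Finset.sum_congr rfl fun k _ => by ring
  have h5 : ∑ k, v k * (Real.log (v k) - Real.log (z k)) =
      ∑ k, v k * Real.log (v k) - ∑ k, v k * Real.log (z k) := by
    rw [← Finset.sum_sub_distrib]
    exact Finset.sum_congr rfl fun k _ => by ring
  rw [h4, h5, Finset.sum_sub_distrib]
  rw [abs_le] at h1 h2 ⊢
  constructor <;> nlinarith

theorem exp_log_sum_eq_dirichletKernel {d : ℕ} {h : ℝ} (hh : 0 < h) {z w : Fin (d + 1) → ℝ}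
    (hz : ∀ k, 0 < z k) (hw : ∀ k, 0 ≤ w k) :
    dirichletKernel h z w = Real.exp (Real.log (Real.Gamma (∑ k, (w k / h + 1)))
      - ∑ k, Real.log (Real.Gamma (w k / h + 1))
        + ∑ k, (w k / h + 1 - 1) * Real.log (z k)) := by
  have hα : ∀ k, 0 < w k / h + 1 := fun k => by have := hw k; positivity
  have hS : 0 < ∑ k, (w k / h + 1) := Finset.sum_pos (fun k _ => hα k) Finset.univ_nonempty
  rw [Real.exp_add, Real.exp_sub, Real.exp_log (Real.Gamma_pos_of_pos hS), Real.exp_sum,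
    Real.exp_sum]
  simp only [dirichletKernel]
  congr 1
  · congr 1
    exact Finset.prod_congr rfl fun k _ => (Real.exp_log (Real.Gamma_pos_of_pos (hα k))).symm
  · refine Finset.prod_congr rfl fun k _ => ?_
    rw [Real.rpow_def_of_pos (hz k), mul_comm]

/-- The mean of the Dirichlet distribution with parameters `w_k / h + 1`. -/
noncomputable def dirichletMean {d : ℕ} (h : ℝ) (w : Fin (d + 1) → ℝ) (k : Fin (d + 1)) : ℝ :=
  (w k + h) / (1 + (d + 1) * h)

section dirichletMean

variable {d : ℕ} {h : ℝ} {z w : Fin (d + 1) → ℝ}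

theorem dirichletMean_pos (hh : 0 < h) (hw : w ∈ stdSimplex ℝ (Fin (d + 1))) (k : Fin (d + 1)) :
    0 < dirichletMean h w k := by
  have := hw.1 k
  unfold dirichletMean
  positivity

theorem sum_dirichletMean (hh : 0 < h) (hw : w ∈ stdSimplex ℝ (Fin (d + 1))) :
    ∑ k, dirichletMean h w k = 1 := by
  unfold dirichletMean
  rw [← Finset.sum_div, Finset.sum_add_distrib, hw.2]
  simp only [Finset.sum_const, Finset.card_univ, Fintype.card_fin, nsmul_eq_mul, Nat.cast_add,
    Nat.cast_one]
  exact div_self (by positivity)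

theorem mul_dirichletMean (hh : 0 < h) (k : Fin (d + 1)) :
    (1 + (d + 1) * h) / h * dirichletMean h w k = w k / h + 1 := by
  have : (1 + (d + 1) * h) ≠ 0 := by positivity
  unfold dirichletMean
  field_simp

theorem dirichletMean_sub (hh : 0 < h) (k : Fin (d + 1)) :
    dirichletMean h w k - z k = (w k - z k + h * (1 - (d + 1) * z k)) / (1 + (d + 1) * h) := by
  have : (1 + (d + 1) * h) ≠ 0 := by positivity
  unfold dirichletMean
  field_simp
  ring

/-- Two-sided asymptotics of the logarithm of the Dirichlet kernel, up to a bounded error. -/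
theorem exists_dirichletKernel_eq_exp (hh : 0 < h) (hh1 : h ≤ 1) (hz : ∀ k, 0 < z k)
    (hw : w ∈ stdSimplex ℝ (Fin (d + 1))) :
    ∃ R : ℝ, |R| ≤ 5 * (d + 2) * (d + 2) ∧ dirichletKernel h z w = (√h ^ d)⁻¹ * Real.exp (R
      + ∑ k, (Real.log (dirichletMean h w k) / 2 - Real.log (z k))
      - (1 + (d + 1) * h) / h *
        ∑ k, dirichletMean h w k * (Real.log (dirichletMean h w k) - Real.log (z k))) := by
  set A := (1 + (d + 1) * h) / h with hA
  set v := dirichletMean h w with hv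
  have hA1 : 1 ≤ A := by
    rw [hA, le_div_iff₀ hh]
    have : 0 ≤ (d : ℝ) * h := by positivity
    linarith
  have hAv : ∀ k, A * v k = w k / h + 1 := mul_dirichletMean hh
  have hS : ∑ k, (w k / h + 1) = A := by
    simp_rw [← hAv, ← Finset.mul_sum]
    rw [hv, sum_dirichletMean hh hw, mul_one]
  have key := abs_log_dirichlet_sub_le (v := v) (z := z) hA1
    (fun k => by rw [hAv]; have := div_nonneg (hw.1 k) hh.le; linarith) (sum_dirichletMean hh hw)
  rw [exp_log_sum_eq_dirichletKernel hh hz hw.1, hS]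
  simp_rw [hAv] at key
  set T := Real.log (Real.Gamma A) - ∑ k, Real.log (Real.Gamma (w k / h + 1))
        + ∑ k, (w k / h + 1 - 1) * Real.log (z k) with hT
  set U := ∑ k, (Real.log (v k) / 2 - Real.log (z k)) with hU
  set V := ∑ k, v k * (Real.log (v k) - Real.log (z k)) with hV
  have hlogA : Real.log A = Real.log (1 + (d + 1) * h) - Real.log h :=
    Real.log_div (by positivity) hh.ne'
  have hl0 : 0 ≤ Real.log (1 + (d + 1) * h) := Real.log_nonneg (by
    have : 0 ≤ ((d : ℝ) + 1) * h := by positivity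
    linarith)
  have hl1 : Real.log (1 + (d + 1) * h) ≤ d + 1 := by
    refine (Real.log_le_sub_one_of_pos (by positivity)).trans ?_
    have : ((d : ℝ) + 1) * h ≤ (d + 1) * 1 := by gcongr
    linarith
  have hpow : (√h ^ d)⁻¹ = Real.exp (-(d / 2 * Real.log h)) := by
    rw [Real.exp_neg, ← Real.exp_log (show 0 < √h ^ d by positivity), Real.log_pow,
      Real.log_sqrt hh.le]
    ring_nf
  -- `R` is whatever makes the identity exact: the Stirling error plus `d / 2 * log (1 + (d + 1) *
  -- h)`, which `h ≤ 1` keeps bounded.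
  refine ⟨T + d / 2 * Real.log h - U + A * V, ?_, ?_⟩
  · have hd : (0 : ℝ) ≤ d := Nat.cast_nonneg d
    rw [abs_le] at key ⊢
    constructor <;> nlinarith
  · rw [hpow, ← Real.exp_add]
    congr 1
    ring

/-- The sup distance is attained at one coordinate, where the quadratic lower bound applies. The
Dirichlet mean is off from `w` by `O(h)`, which after squaring and multiplying by `1 / h` costs only
the subtracted constant. -/
theorem sum_sq_div_le_mul_klDiv (hh : 0 < h) (hh1 : h ≤ 1) (hz : z ∈ openSimplex d)
    (hw : w ∈ stdSimplex ℝ (Fin (d + 1))) :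
    (dist w z / √h) ^ 2 / (8 * (d + 2)) - (d + 2) ^ 2 ≤ (1 + (d + 1) * h) / h *
        ∑ k, dirichletMean h w k * (Real.log (dirichletMean h w k) - Real.log (z k)) := by
  have h1 := sum_sq_le_klDiv (dirichletMean_pos hh hw) hz.1 (sum_dirichletMean hh hw) hz.2
  obtain ⟨k, hk⟩ : ∃ k, dist w z ≤ |w k - z k| := by
    obtain ⟨k, -, hk⟩ := Finset.exists_max_image Finset.univ (fun k => dist (w k) (z k))
      Finset.univ_nonempty
    exact ⟨k, (dist_pi_le_iff dist_nonneg).2 fun j => hk j (Finset.mem_univ j)⟩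
  have h2 : (dirichletMean h w k - z k) ^ 2 ≤ ∑ k, (dirichletMean h w k - z k) ^ 2 :=
    Finset.single_le_sum (f := fun k => (dirichletMean h w k - z k) ^ 2)
      (fun i _ => sq_nonneg _) (Finset.mem_univ k)
  have hzk1 : z k ≤ 1 :=
    hz.2 ▸ Finset.single_le_sum (fun i _ => (hz.1 i).le) (Finset.mem_univ k)
  have hzk0 := hz.1 k
  have hd : (0 : ℝ) ≤ d := Nat.cast_nonneg d
  have hB : 0 < 1 + (d + 1) * h := by positivity
  have hB2 : 1 + (d + 1) * h ≤ d + 2 := by nlinarith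
  set B := 1 + (d + 1) * h with hBdef
  set e := 1 - (d + 1) * z k with he
  have he2 : e ^ 2 ≤ (d + 2) ^ 2 := by
    apply sq_le_sq'
    · nlinarith
    · nlinarith
  have h3 : (dist w z) ^ 2 ≤ (w k - z k) ^ 2 := by
    rw [← sq_abs (w k - z k)]
    exact pow_le_pow_left₀ dist_nonneg hk 2
  have h4 : (dist w z) ^ 2 / 2 - h ^ 2 * (d + 2) ^ 2 ≤ (w k - z k + h * e) ^ 2 := by
    nlinarith [sq_nonneg ((w k - z k) + 2 * (h * e)), mul_le_mul_of_nonneg_left he2 (sq_nonneg h)]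
  rw [dirichletMean_sub hh] at h2
  have h5 : B / h * (((w k - z k + h * e) / B) ^ 2 / 4) ≤ B / h *
        ∑ k, dirichletMean h w k * (Real.log (dirichletMean h w k) - Real.log (z k)) := by
    gcongr
    linarith
  refine le_trans ?_ h5
  rw [show B / h * (((w k - z k + h * e) / B) ^ 2 / 4) = (w k - z k + h * e) ^ 2 / (4 * B * h) by
    field_simp]
  have h6 : ((dist w z) ^ 2 / 2 - h ^ 2 * (d + 2) ^ 2) / (4 * B * h) ≤
      (w k - z k + h * e) ^ 2 / (4 * B * h) := by gcongr
  refine le_trans ?_ h6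
  rw [sub_div, div_pow, Real.sq_sqrt hh.le]
  have h7 : (dist w z) ^ 2 / h / (8 * (d + 2)) ≤ (dist w z) ^ 2 / 2 / (4 * B * h) := by
    rw [div_div, div_div]
    refine div_le_div_of_nonneg_left (sq_nonneg _) (by positivity) ?_
    nlinarith
  have h8 : h ^ 2 * (d + 2) ^ 2 / (4 * B * h) ≤ ((d : ℝ) + 2) ^ 2 := by
    rw [div_le_iff₀ (by positivity), mul_comm]
    gcongr
    have : 1 ≤ B := by rw [hBdef]; nlinarith
    nlinarith
  linarith

/-- Within distance `√h` of `z` the Dirichlet mean also stays within `O(√h)`, so the chi-squared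
bound is `O(h)` and the factor `1 / h` is absorbed. -/
theorem mul_klDiv_le (hh : 0 < h) (hh1 : h ≤ 1) (hz : z ∈ openSimplex d)
    (hw : w ∈ stdSimplex ℝ (Fin (d + 1))) (hwz : dist w z ≤ √h) :
    (1 + (d + 1) * h) / h *
        ∑ k, dirichletMean h w k * (Real.log (dirichletMean h w k) - Real.log (z k)) ≤
      ∑ k, (d + 3) ^ 2 / z k := by
  have h1 := klDiv_le_chiSq (dirichletMean_pos hh hw) hz.1 (sum_dirichletMean hh hw) hz.2
  have hd : (0 : ℝ) ≤ d := Nat.cast_nonneg d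
  have hB : 1 ≤ 1 + (d + 1) * h := by nlinarith
  have hB0 : 0 < 1 + (d + 1) * h := by linarith
  refine (mul_le_mul_of_nonneg_left h1 (by positivity)).trans ?_
  rw [Finset.mul_sum]
  refine Finset.sum_le_sum fun k _ => ?_
  have hzk1 : z k ≤ 1 :=
    hz.2 ▸ Finset.single_le_sum (fun i _ => (hz.1 i).le) (Finset.mem_univ k)
  have hzk0 := hz.1 k
  rw [← mul_div_assoc, dirichletMean_sub hh]
  set B := 1 + (d + 1) * h with hBdef
  set e := 1 - (d + 1) * z k with he
  gcongr
  have hs : √h ^ 2 = h := Real.sq_sqrt hh.le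
  have hs1 : √h ≤ 1 := Real.sqrt_le_one.2 hh1
  have hs0 : 0 ≤ √h := Real.sqrt_nonneg h
  have h2 : |w k - z k| ≤ √h := (dist_le_pi_dist w z k).trans hwz
  have h3 : |h * e| ≤ √h * (d + 2) := by
    rw [abs_mul, abs_of_pos hh]
    have : |e| ≤ d + 2 := by
      rw [abs_le]
      constructor <;> nlinarith
    have h' : h ≤ √h := by nlinarith
    gcongr
  have h4 : |w k - z k + h * e| ≤ √h * (d + 3) := (abs_add_le _ _).trans (by linarith)
  have h5 : (w k - z k + h * e) ^ 2 ≤ h * (d + 3) ^ 2 := by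
    rw [← sq_abs]
    refine (pow_le_pow_left₀ (abs_nonneg _) h4 2).trans (le_of_eq ?_)
    rw [mul_pow, hs]
  rw [show B / h * ((w k - z k + h * e) / B) ^ 2 = (w k - z k + h * e) ^ 2 / (h * B) by
    field_simp, div_le_iff₀ (by positivity)]
  refine h5.trans ?_
  have : h * (d + 3) ^ 2 * 1 ≤ h * (d + 3) ^ 2 * B := by gcongr
  linarith

/-- Gaussian upper bound for the Dirichlet kernel at an interior point. -/
theorem exists_dirichletKernel_le (hz : z ∈ openSimplex d) :
    ∃ C > 0, ∃ c > 0, ∀ h, 0 < h → h ≤ 1 → ∀ w ∈ stdSimplex ℝ (Fin (d + 1)),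
      dirichletKernel h z w ≤ C * (√h ^ d)⁻¹ * Real.exp (-(c * (dist w z / √h) ^ 2)) := by
  refine ⟨Real.exp (5 * (d + 2) * (d + 2) + ∑ k, (- Real.log (z k)) + (d + 2) ^ 2),
    Real.exp_pos _, 1 / (8 * (d + 2)), by positivity, fun h hh hh1 w hw => ?_⟩
  obtain ⟨R, hR, heq⟩ := exists_dirichletKernel_eq_exp hh hh1 hz.1 hw
  have h1 := sum_sq_div_le_mul_klDiv hh hh1 hz hw
  have h2 : ∑ k, (Real.log (dirichletMean h w k) / 2 - Real.log (z k)) ≤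
      ∑ k, (- Real.log (z k)) := by
    refine Finset.sum_le_sum fun k _ => ?_
    have : dirichletMean h w k ≤ 1 := sum_dirichletMean hh hw ▸
      Finset.single_le_sum (fun i _ => (dirichletMean_pos hh hw i).le) (Finset.mem_univ k)
    have := Real.log_nonpos (dirichletMean_pos hh hw k).le this
    linarith
  rw [heq, mul_comm (Real.exp _), mul_assoc, ← Real.exp_add]
  gcongr
  have := (abs_le.1 hR).2
  rw [div_eq_mul_one_div] at h1
  linarith

/-- Lower bound for the Dirichlet kernel near an interior point. -/
theorem exists_le_dirichletKernel (hz : z ∈ openSimplex d) :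
    ∃ c > 0, ∀ᶠ h in 𝓝[>] (0 : ℝ), ∀ w ∈ stdSimplex ℝ (Fin (d + 1)), dist w z ≤ √h →
      c * (√h ^ d)⁻¹ ≤ dirichletKernel h z w := by
  refine ⟨Real.exp (-(5 * (d + 2) * (d + 2)) + ∑ k, (Real.log (z k / 2) / 2 - Real.log (z k))
    - ∑ k, (d + 3) ^ 2 / z k), Real.exp_pos _, ?_⟩
  -- This keeps the coordinates of the mean away from zero, hence their logarithms bounded below.
  have hsmall : ∀ᶠ h in 𝓝[>] (0 : ℝ), ∀ k, z k / 2 ≤ (z k - √h) / (1 + (d + 1) * h) := by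
    rw [eventually_all]
    intro k
    have : Tendsto (fun h : ℝ => (z k - √h) / (1 + (d + 1) * h)) (𝓝[>] 0) (𝓝 (z k)) := by
      have hc : ContinuousAt (fun h : ℝ => (z k - √h) / (1 + (d + 1) * h)) 0 := by
        refine ContinuousAt.div (by fun_prop) (by fun_prop) (by simp)
      have := hc.tendsto.mono_left (nhdsWithin_le_nhds (s := Set.Ioi 0))
      simpa using this
    exact (this.eventually (lt_mem_nhds (half_lt_self (hz.1 k)))).mono fun _ h => h.le
  filter_upwards [hsmall, Ioo_mem_nhdsGT (zero_lt_one (α := ℝ))] with h hs hh w hw hwz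
  have hh0 : 0 < h := hh.1
  obtain ⟨R, hR, heq⟩ := exists_dirichletKernel_eq_exp hh0 hh.2.le hz.1 hw
  have h1 := mul_klDiv_le hh0 hh.2.le hz hw hwz
  have h2 : ∑ k, (Real.log (z k / 2) / 2 - Real.log (z k)) ≤
      ∑ k, (Real.log (dirichletMean h w k) / 2 - Real.log (z k)) := by
    refine Finset.sum_le_sum fun k _ => ?_
    have h3 : |w k - z k| ≤ √h := (dist_le_pi_dist w z k).trans hwz
    have h4 : z k / 2 ≤ dirichletMean h w k := by
      refine (hs k).trans ?_
      unfold dirichletMean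
      gcongr
      have := (abs_le.1 h3).1
      linarith
    have h5 : Real.log (z k / 2) ≤ Real.log (dirichletMean h w k) :=
      Real.log_le_log (half_pos (hz.1 k)) h4
    linarith
  rw [heq, mul_comm (Real.exp _)]
  gcongr
  have := (abs_le.1 hR).1
  linarith

theorem dirichletKernel_nonneg (hh : 0 < h) (hz : z ∈ stdSimplex ℝ (Fin (d + 1)))
    (hw : w ∈ stdSimplex ℝ (Fin (d + 1))) : 0 ≤ dirichletKernel h z w := by
  have hα : ∀ k, 0 < w k / h + 1 := fun k => by have := hw.1 k; positivity
  refine mul_nonneg (div_nonneg (Real.Gamma_nonneg_of_nonneg ?_)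
    (Finset.prod_nonneg fun k _ => Real.Gamma_nonneg_of_nonneg (hα k).le))
    (Finset.prod_nonneg fun k _ => Real.rpow_nonneg (hz.1 k) _)
  exact Finset.sum_nonneg fun k _ => (hα k).le

end dirichletMean

/-! ### Measurability of the kernel. -/

/-- `Γ` is continuous off the countable set of its poles, and on a countable set every function is
measurable. -/
theorem measurable_realGamma : Measurable Real.Gamma := by
  set S : Set ℝ := Set.range fun m : ℕ => -(m : ℝ) with hS
  have hSc : S.Countable := Set.countable_range _
  have hSm : MeasurableSet S := hSc.measurableSet
  refine measurable_of_restrict_of_restrict_compl hSm ?_ ?_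
  · have := hSc.to_subtype
    exact measurable_of_countable _
  · refine ContinuousOn.domRestrict (fun s hs => ?_) |>.measurable
    exact (Real.differentiableAt_Gamma fun m hm =>
      hs ⟨m, hm.symm⟩).continuousAt.continuousWithinAt

theorem measurable_dirichletKernel {d : ℕ} (h : ℝ) :
    Measurable fun q : (Fin (d + 1) → ℝ) × (Fin (d + 1) → ℝ) => dirichletKernel h q.1 q.2 := by
  unfold dirichletKernel
  have := measurable_realGamma
  have hw : ∀ k : Fin (d + 1), Measurable fun q : (Fin (d + 1) → ℝ) × (Fin (d + 1) → ℝ) =>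
    q.2 k / h + 1 := fun k => by fun_prop
  refine Measurable.mul (Measurable.div (this.comp ?_) ?_) ?_
  · exact Finset.measurable_sum _ fun k _ => hw k
  · exact Finset.measurable_prod _ fun k _ => this.comp (hw k)
  · exact Finset.measurable_prod _ fun k _ => Measurable.pow (by fun_prop) ((hw k).sub_const 1)

/-! ### Mass of small balls under the law of the prediction. -/

section growth

variable {d : ℕ}

theorem simplexChart_init {z : Fin (d + 1) → ℝ} (hz : ∑ k, z k = 1) :
    simplexChart d (Fin.init z) = z := by
  have : 1 - ∑ i, Fin.init z i = z (Fin.last d) := by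
    rw [Fin.sum_univ_castSucc] at hz
    simp only [Fin.init]
    linarith
  rw [simplexChart, this, Fin.snoc_init_self]

theorem sum_simplexChart (s : Fin d → ℝ) : ∑ k, simplexChart d s k = 1 := by
  rw [Fin.sum_univ_castSucc]
  simp [simplexChart]

theorem dist_simplexChart_le (s t : Fin d → ℝ) :
    dist (simplexChart d s) (simplexChart d t) ≤ (d + 1) * dist s t := by
  have h0 : 0 ≤ dist s t := dist_nonneg
  have hd : (0 : ℝ) ≤ d := Nat.cast_nonneg d
  refine (dist_pi_le_iff (by positivity)).2 fun k => ?_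
  refine Fin.lastCases ?_ (fun i => ?_) k
  · simp only [simplexChart, Fin.snoc_last, Real.dist_eq]
    have h1 : (1 - ∑ i, s i - (1 - ∑ i, t i)) = ∑ i, (t i - s i) := by
      rw [Finset.sum_sub_distrib]; ring
    rw [h1]
    refine (Finset.abs_sum_le_sum_abs _ _).trans ?_
    have h2 : ∀ i ∈ Finset.univ, |t i - s i| ≤ dist s t := fun i _ => by
      rw [dist_comm]; exact dist_le_pi_dist t s i
    refine (Finset.sum_le_sum h2).trans ?_
    simp only [Finset.sum_const, Finset.card_univ, Fintype.card_fin, nsmul_eq_mul]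
    nlinarith
  · simp only [simplexChart, Fin.snoc_castSucc]
    have := dist_le_pi_dist s t i
    nlinarith

theorem measurableSet_openSimplex : MeasurableSet (openSimplex d) := by
  have : openSimplex d = (⋂ i, {s | 0 < s i}) ∩ {s | ∑ i, s i = 1} := by
    ext s; simp [openSimplex]
  rw [this]
  exact (MeasurableSet.iInter fun i => measurableSet_lt measurable_const
    (measurable_pi_apply i)).inter (measurableSet_eq_fun (by fun_prop) measurable_const)

/-- Almost every point of the simplex is interior. -/
theorem ae_mem_openSimplex : ∀ᵐ z ∂(simplexVolume d), z ∈ openSimplex d := by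
  set S : Set (Fin d → ℝ) := {s | (∀ i, 0 ≤ s i) ∧ ∑ i, s i ≤ 1} with hS
  have hconv : Convex ℝ S := by
    rintro s ⟨hs0, hs1⟩ t ⟨ht0, ht1⟩ a b ha hb hab
    refine ⟨fun i => ?_, ?_⟩
    · have h1 := hs0 i
      have h2 := ht0 i
      simp only [Pi.add_apply, Pi.smul_apply, smul_eq_mul]
      positivity
    · simp only [Pi.add_apply, Pi.smul_apply, smul_eq_mul, Finset.sum_add_distrib,
        ← Finset.mul_sum]
      nlinarith
  have hSm : MeasurableSet S := by
    have : S = (⋂ i, {s | 0 ≤ s i}) ∩ {s | ∑ i, s i ≤ 1} := by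
      ext s; simp [hS]
    rw [this]
    exact (MeasurableSet.iInter fun i => measurableSet_le measurable_const
      (measurable_pi_apply i)).inter (measurableSet_le (by fun_prop) measurable_const)
  rw [simplexVolume, ae_map_iff (p := (· ∈ openSimplex d))
    (measurable_simplexChart d).aemeasurable measurableSet_openSimplex,
    ae_restrict_iff' hSm]
  -- The frontier of a convex set is Lebesgue-null. At an interior point, all coordinates can be
  -- shifted by `-ε` or `+ε`, which makes the constraints strict.
  have hfr : ∀ᵐ s ∂(volume : Measure (Fin d → ℝ)), s ∉ frontier S :=
    measure_eq_zero_iff_ae_notMem.1 (hconv.addHaar_frontier volume)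
  filter_upwards [hfr] with s hs hsS
  have hint : s ∈ interior S := by
    by_contra h
    exact hs ⟨subset_closure hsS, h⟩
  obtain ⟨ε, hε, hball⟩ :=
    Metric.nhds_basis_closedBall.mem_iff.1 (mem_interior_iff_mem_nhds.1 hint)
  have hm : (fun i => s i - ε) ∈ S := hball (by
    rw [Metric.mem_closedBall, dist_pi_le_iff hε.le]
    intro i
    simp [abs_of_pos hε])
  have hp : (fun i => s i + ε) ∈ S := hball (by
    rw [Metric.mem_closedBall, dist_pi_le_iff hε.le]
    intro i
    simp [abs_of_pos hε])
  refine ⟨fun k => ?_, sum_simplexChart s⟩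
  refine Fin.lastCases ?_ (fun i => ?_) k
  · simp only [simplexChart, Fin.snoc_last]
    have h1 := hp.2
    simp only [Finset.sum_add_distrib, Finset.sum_const, Finset.card_univ, Fintype.card_fin,
      nsmul_eq_mul] at h1
    rcases Nat.eq_zero_or_pos d with rfl | hd
    · simp
    · have : (0 : ℝ) < d := by exact_mod_cast hd
      nlinarith [mul_pos this hε]
  · simp only [simplexChart, Fin.snoc_castSucc]
    have h1 : 0 ≤ s i - ε := hm.1 i
    linarith

/-- Dropping the last coordinate does not increase sup distances, so the preimage lies in a
`d`-dimensional ball of the same radius. -/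
theorem simplexVolume_closedBall_le (z : Fin (d + 1) → ℝ) {r : ℝ} (hr : 0 ≤ r) :
    simplexVolume d (Metric.closedBall z r) ≤ ENNReal.ofReal ((2 * r) ^ d) := by
  rw [simplexVolume, Measure.map_apply (measurable_simplexChart d)
    Metric.isClosed_closedBall.measurableSet]
  calc _ ≤ volume (simplexChart d ⁻¹' Metric.closedBall z r) := Measure.restrict_apply_le _ _
    _ ≤ volume (Metric.closedBall (Fin.init z : Fin d → ℝ) r) := by
        refine measure_mono fun s hs => ?_
        rw [Metric.mem_closedBall, dist_pi_le_iff hr]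
        intro i
        have := (dist_le_pi_dist (simplexChart d s) z i.castSucc).trans hs
        simpa [simplexChart, Fin.init] using this
    _ = ENNReal.ofReal ((2 * r) ^ d) := by
        rw [Real.volume_pi_closedBall _ hr, Fintype.card_fin]

/-- The chart is `(d + 1)`-Lipschitz, so the ball of radius `r / (d + 1)` maps into the given one;
it stays in the simplex once `r` is below every coordinate of `z`. -/
theorem exists_le_simplexVolume_closedBall {z : Fin (d + 1) → ℝ} (hz : z ∈ openSimplex d) :
    ∀ᶠ r in 𝓝[>] (0 : ℝ), ENNReal.ofReal ((2 * (r / (d + 1))) ^ d) ≤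
      simplexVolume d (Metric.closedBall z r) := by
  have hsmall : ∀ᶠ r in 𝓝[>] (0 : ℝ), ∀ k, r < z k := by
    rw [eventually_all]
    exact fun k => nhdsWithin_le_nhds (gt_mem_nhds (hz.1 k))
  filter_upwards [hsmall, self_mem_nhdsWithin] with r hr hr0
  have hr0 : 0 < r := hr0
  rw [simplexVolume, Measure.map_apply (measurable_simplexChart d)
    Metric.isClosed_closedBall.measurableSet]
  have hsub : Metric.closedBall (Fin.init z : Fin d → ℝ) (r / (d + 1)) ⊆
      simplexChart d ⁻¹' Metric.closedBall z r := by
    intro s hs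
    rw [Set.mem_preimage, Metric.mem_closedBall, ← simplexChart_init hz.2]
    refine (dist_simplexChart_le _ _).trans ?_
    rw [Metric.mem_closedBall, le_div_iff₀ (by positivity)] at hs
    linarith
  refine le_trans ?_ (Measure.le_restrict_apply _ _)
  refine le_trans ?_ (measure_mono (Set.subset_inter hsub fun s hs => ?_))
  · rw [Real.volume_pi_closedBall _ (by positivity), Fintype.card_fin]
  · have hpos : ∀ k, 0 ≤ simplexChart d s k := fun k => by
      have h1 := (dist_le_pi_dist (simplexChart d s) z k).trans (hsub hs)
      rw [Real.dist_eq] at h1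
      have h2 := (abs_le.1 h1).1
      have h3 := hr k
      linarith
    refine ⟨fun i => by simpa [simplexChart] using hpos i.castSucc, ?_⟩
    have := hpos (Fin.last d)
    simp only [simplexChart, Fin.snoc_last] at this
    linarith

variable {ρ : (Fin (d + 1) → ℝ) → ℝ≥0} {L : ℝ≥0}

/-- A Lipschitz density on a set of diameter at most `1` is bounded, so `b` can be chosen
independently of the centre. -/
theorem exists_withDensity_closedBall_le (hρ : LipschitzOnWith L ρ (openSimplex d)) :
    ∃ b : ℝ, 0 ≤ b ∧ ∀ z : Fin (d + 1) → ℝ, ∀ r, 0 ≤ r →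
      (simplexVolume d).withDensity (fun s => (ρ s : ℝ≥0∞)) (Metric.closedBall z r) ≤
        ENNReal.ofReal (b * r ^ d) := by
  obtain ⟨B, hB⟩ : ∃ B : ℝ≥0, ∀ z ∈ openSimplex d, ρ z ≤ B := by
    rcases (openSimplex d).eq_empty_or_nonempty with he | ⟨u, hu⟩
    · exact ⟨0, by simp [he]⟩
    · refine ⟨ρ u + L, fun z hz => ?_⟩
      have h1 := hρ.dist_le_mul z hz u hu
      have h2 : dist z u ≤ 1 := by
        refine (dist_pi_le_iff zero_le_one).2 fun k => ?_
        have hzk : z k ≤ 1 :=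
          hz.2 ▸ Finset.single_le_sum (fun i _ => (hz.1 i).le) (Finset.mem_univ k)
        have huk : u k ≤ 1 :=
          hu.2 ▸ Finset.single_le_sum (fun i _ => (hu.1 i).le) (Finset.mem_univ k)
        have := hz.1 k
        have := hu.1 k
        rw [Real.dist_eq, abs_le]
        constructor <;> linarith
      rw [NNReal.dist_eq] at h1
      have h3 := (abs_le.1 h1).2
      have h4 : (L : ℝ) * dist z u ≤ L * 1 := by gcongr
      rw [← NNReal.coe_le_coe]
      push_cast
      linarith
  refine ⟨B * 2 ^ d, by positivity, fun z r hr => ?_⟩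
  rw [withDensity_apply _ Metric.isClosed_closedBall.measurableSet]
  calc _ ≤ ∫⁻ _ in Metric.closedBall z r, (B : ℝ≥0∞) ∂(simplexVolume d) := by
        refine lintegral_mono_ae (ae_restrict_of_ae ?_)
        filter_upwards [ae_mem_openSimplex] with w hw
        exact_mod_cast hB w hw
    _ = B * simplexVolume d (Metric.closedBall z r) := by
        rw [lintegral_const, Measure.restrict_apply_univ]
    _ ≤ B * ENNReal.ofReal ((2 * r) ^ d) := by
        gcongr
        exact simplexVolume_closedBall_le z hr
    _ = _ := by
        rw [← ENNReal.ofReal_coe_nnreal, ← ENNReal.ofReal_mul (by positivity), mul_pow, mul_assoc]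

/-- By continuity the density is at least `ρ z / 2` on the part of a small ball inside the open
simplex. -/
theorem exists_le_withDensity_closedBall (hρ : LipschitzOnWith L ρ (openSimplex d))
    {z : Fin (d + 1) → ℝ} (hz : z ∈ openSimplex d) (hρz : 0 < ρ z) :
    ∃ a > 0, ∀ᶠ r in 𝓝[>] (0 : ℝ), ENNReal.ofReal (a * r ^ d) ≤
      (simplexVolume d).withDensity (fun s => (ρ s : ℝ≥0∞)) (Metric.closedBall z r) := by
  refine ⟨ρ z / 2 * (2 / (d + 1)) ^ d, by positivity, ?_⟩
  have hcont : ∀ᶠ r in 𝓝[>] (0 : ℝ), ∀ w ∈ Metric.closedBall z r, w ∈ openSimplex d →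
      ρ z / 2 ≤ ρ w := by
    have h1 := (hρ.continuousOn z hz).eventually (lt_mem_nhds (half_lt_self hρz))
    rw [eventually_nhdsWithin_iff, Metric.eventually_nhds_iff_ball] at h1
    obtain ⟨ε, hε, hball⟩ := h1
    filter_upwards [Ioo_mem_nhdsGT hε] with r hr w hw hwo
    exact (hball w (Metric.closedBall_subset_ball hr.2 hw) hwo).le
  filter_upwards [hcont, exists_le_simplexVolume_closedBall hz, self_mem_nhdsWithin]
    with r hr hv hr0
  have hr0 : 0 < r := hr0
  rw [withDensity_apply _ Metric.isClosed_closedBall.measurableSet]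
  calc ENNReal.ofReal (ρ z / 2 * (2 / (d + 1)) ^ d * r ^ d)
      = ((ρ z / 2 : ℝ≥0) : ℝ≥0∞) * ENNReal.ofReal ((2 * (r / (d + 1))) ^ d) := by
        rw [← ENNReal.ofReal_coe_nnreal, ← ENNReal.ofReal_mul (by positivity)]
        congr 1
        push_cast
        rw [mul_assoc, ← mul_pow]
        congr 2
        ring
    _ ≤ (ρ z / 2 : ℝ≥0) * simplexVolume d (Metric.closedBall z r) := by gcongr
    _ = ∫⁻ _ in Metric.closedBall z r, ((ρ z / 2 : ℝ≥0) : ℝ≥0∞) ∂(simplexVolume d) := by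
        rw [lintegral_const, Measure.restrict_apply_univ]
    _ ≤ _ := by
        refine lintegral_mono_ae ?_
        filter_upwards [ae_restrict_of_ae ae_mem_openSimplex,
          ae_restrict_mem Metric.isClosed_closedBall.measurableSet] with w hw hwr
        exact_mod_cast hr w hwr hw

theorem ae_withDensity_mem_openSimplex (hρ : LipschitzOnWith L ρ (openSimplex d)) :
    ∀ᵐ z ∂((simplexVolume d).withDensity (fun s => (ρ s : ℝ≥0∞))),
      z ∈ openSimplex d ∧ 0 < ρ z := by
  have hm : AEMeasurable ρ (simplexVolume d) := by
    have := hρ.continuousOn.aemeasurable (μ := simplexVolume d) measurableSet_openSimplex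
    rwa [Measure.restrict_eq_self_of_ae_mem ae_mem_openSimplex] at this
  have hmem : ∀ᵐ z ∂((simplexVolume d).withDensity (fun s => (ρ s : ℝ≥0∞))),
      z ∈ openSimplex d := (withDensity_absolutelyContinuous _ _).ae_le ae_mem_openSimplex
  refine hmem.and ?_
  rw [ae_withDensity_iff' hm.coe_nnreal_ennreal]
  filter_upwards with z hz
  exact pos_iff_ne_zero.2 (by exact_mod_cast hz)

end growth

/-! ### Gaussian averages controlled by averages over balls. -/

section gaussian

variable {E : Type*} [PseudoMetricSpace E] {z : E} {c : ℝ} {d : ℕ}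

/-- The single term `j = ⌊dist w z / r⌋₊` already dominates, because `j ≤ j ^ 2`. The exponential
weights will beat the polynomial growth of the balls' mass. -/
theorem ofReal_exp_neg_le_tsum_indicator (hc : 0 < c) {r : ℝ} (hr : 0 < r) (w : E) :
    ENNReal.ofReal (Real.exp (-(c * (dist w z / r) ^ 2))) ≤
      ∑' j : ℕ, (Metric.closedBall z ((j + 1) * r)).indicator
        (fun _ => ENNReal.ofReal (Real.exp (-c * j))) w := by
  set t := dist w z / r with ht
  have ht0 : 0 ≤ t := by positivity
  refine le_trans ?_ (ENNReal.le_tsum ⌊t⌋₊)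
  have h1 : t < ⌊t⌋₊ + 1 := Nat.lt_floor_add_one t
  have h2 : (⌊t⌋₊ : ℝ) ≤ t := Nat.floor_le ht0
  rw [Set.indicator_of_mem]
  · apply ENNReal.ofReal_le_ofReal
    rw [Real.exp_le_exp, neg_mul, neg_le_neg_iff]
    gcongr
    have h3 : (⌊t⌋₊ : ℝ) ≤ (⌊t⌋₊ : ℝ) ^ 2 := by
      exact_mod_cast Nat.le_self_pow two_ne_zero _
    exact h3.trans (by gcongr)
  · rw [Metric.mem_closedBall, ← div_le_iff₀ hr]
    exact h1.le

variable [MeasurableSpace E] {ν : Measure E}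

theorem lintegral_exp_neg_mul_le_tsum [OpensMeasurableSpace E] (hc : 0 < c) {r : ℝ} (hr : 0 < r)
    {g : E → ℝ≥0∞} (hg : Measurable g) :
    ∫⁻ w, ENNReal.ofReal (Real.exp (-(c * (dist w z / r) ^ 2))) * g w ∂ν ≤
      ∑' j : ℕ, ENNReal.ofReal (Real.exp (-c * j)) *
        ∫⁻ w in Metric.closedBall z ((j + 1) * r), g w ∂ν := by
  calc _ ≤ ∫⁻ w, ∑' j : ℕ, (Metric.closedBall z ((j + 1) * r)).indicator
        (fun w => ENNReal.ofReal (Real.exp (-c * j)) * g w) w ∂ν := by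
        refine lintegral_mono fun w => ?_
        refine (mul_le_mul_left (ofReal_exp_neg_le_tsum_indicator (z := z) hc hr w) _).trans
          (le_of_eq ?_)
        rw [← ENNReal.tsum_mul_right]
        refine tsum_congr fun j => ?_
        by_cases hw : w ∈ Metric.closedBall z ((j + 1) * r) <;> simp [hw]
    _ = _ := by
        rw [lintegral_tsum fun j => ((hg.const_mul _).indicator
          Metric.isClosed_closedBall.measurableSet).aemeasurable]
        refine tsum_congr fun j => ?_
        rw [lintegral_indicator Metric.isClosed_closedBall.measurableSet,
          lintegral_const_mul _ hg]

theorem summable_exp_neg_mul_pow (hc : 0 < c) (b : ℝ) (d : ℕ) :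
    Summable fun j : ℕ => Real.exp (-c * j) * (b * ((j : ℝ) + 1) ^ d) := by
  have h1 := ((summable_nat_add_iff 1).2 (Real.summable_pow_mul_exp_neg_nat_mul d hc)).mul_left
    (b * Real.exp c)
  refine h1.congr fun j => ?_
  push_cast
  rw [show -c * ((j : ℝ) + 1) = -c * j + -c by ring, Real.exp_add, Real.exp_neg c]
  have := (Real.exp_pos c).ne'
  field_simp

variable {b : ℝ}

/-- The bound does not depend on `r`, so it can serve as the dominating sequence when `r` tends to
zero. -/
theorem scaled_setLIntegral_le (hb : ∀ r, 0 ≤ r → ν (Metric.closedBall z r) ≤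
      ENNReal.ofReal (b * r ^ d)) {g : E → ℝ≥0∞} (hg1 : ∀ w, g w ≤ 1) {r : ℝ} (hr : 0 < r) (j : ℕ) :
    ENNReal.ofReal (r ^ d)⁻¹ * ∫⁻ w in Metric.closedBall z ((j + 1) * r), g w ∂ν ≤
      ENNReal.ofReal (b * ((j : ℝ) + 1) ^ d) := by
  have h1 : ∫⁻ w in Metric.closedBall z ((j + 1) * r), g w ∂ν ≤
      ENNReal.ofReal (b * ((j + 1) * r) ^ d) := by
    calc _ ≤ ∫⁻ w in Metric.closedBall z ((j + 1) * r), 1 ∂ν := lintegral_mono hg1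
      _ = ν (Metric.closedBall z ((j + 1) * r)) := by simp
      _ ≤ _ := hb _ (by positivity)
  refine (mul_le_mul_right h1 _).trans (le_of_eq ?_)
  rw [← ENNReal.ofReal_mul (by positivity)]
  congr 1
  rw [mul_pow]
  field_simp

/-- If balls of radius `r` centred at `z` have mass `O(r ^ d)`, then Gaussians of width `r` centred at `z` have
integral `O(r ^ d)`. -/
theorem scaled_lintegral_exp_le [OpensMeasurableSpace E] (hc : 0 < c) (hb0 : 0 ≤ b)
    (hb : ∀ r, 0 ≤ r → ν (Metric.closedBall z r) ≤ ENNReal.ofReal (b * r ^ d)) {r : ℝ}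
    (hr : 0 < r) :
    ENNReal.ofReal (r ^ d)⁻¹ * ∫⁻ w, ENNReal.ofReal (Real.exp (-(c * (dist w z / r) ^ 2))) ∂ν ≤
      ENNReal.ofReal (∑' j : ℕ, Real.exp (-c * j) * (b * ((j : ℝ) + 1) ^ d)) := by
  have h1 := lintegral_exp_neg_mul_le_tsum (ν := ν) (z := z) hc hr
    (measurable_const (a := (1 : ℝ≥0∞)))
  simp only [mul_one] at h1
  refine (mul_le_mul_right h1 _).trans ?_
  rw [← ENNReal.tsum_mul_left, ENNReal.ofReal_tsum_of_nonneg (fun j => by positivity)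
    (summable_exp_neg_mul_pow hc b d)]
  refine ENNReal.tsum_le_tsum fun j => ?_
  rw [mul_left_comm, ENNReal.ofReal_mul (Real.exp_pos _).le]
  gcongr
  exact scaled_setLIntegral_le hb (fun _ => le_rfl) hr j

/-- Gaussian averages of a bounded function tend to zero where its averages over balls do. -/
theorem tendsto_scaled_lintegral_exp_mul [OpensMeasurableSpace E] (hc : 0 < c) (hb0 : 0 ≤ b)
    (hb : ∀ r, 0 ≤ r → ν (Metric.closedBall z r) ≤ ENNReal.ofReal (b * r ^ d)) {g : E → ℝ≥0∞}
    (hg : Measurable g) (hg1 : ∀ w, g w ≤ 1)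
    (hlim : Tendsto (fun r : ℝ => ENNReal.ofReal (r ^ d)⁻¹ *
      ∫⁻ w in Metric.closedBall z r, g w ∂ν) (𝓝[>] 0) (𝓝 0)) :
    Tendsto (fun r : ℝ => ENNReal.ofReal (r ^ d)⁻¹ *
      ∫⁻ w, ENNReal.ofReal (Real.exp (-(c * (dist w z / r) ^ 2))) * g w ∂ν) (𝓝[>] 0) (𝓝 0) := by
  -- For fixed `j`, substitute the radius `(j + 1) * r`; the normalisation changes by the constant
  -- `(j + 1) ^ d`.
  have hterm : ∀ j : ℕ, Tendsto (fun r : ℝ => ENNReal.ofReal (Real.exp (-c * j)) *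
      (ENNReal.ofReal (r ^ d)⁻¹ * ∫⁻ w in Metric.closedBall z ((j + 1) * r), g w ∂ν))
      (𝓝[>] 0) (𝓝 0) := by
    intro j
    have hj : (0 : ℝ) < (j : ℝ) + 1 := by positivity
    have hscale : Tendsto (fun r : ℝ => ((j : ℝ) + 1) * r) (𝓝[>] 0) (𝓝[>] 0) := by
      refine tendsto_nhdsWithin_iff.2 ⟨?_, ?_⟩
      · have : Tendsto (fun r : ℝ => ((j : ℝ) + 1) * r) (𝓝 0) (𝓝 (((j : ℝ) + 1) * 0)) :=
          Continuous.tendsto (by fun_prop) _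
        rw [mul_zero] at this
        exact this.mono_left nhdsWithin_le_nhds
      · filter_upwards [self_mem_nhdsWithin] with r hr
        exact mul_pos hj hr
    have h1 := ENNReal.Tendsto.const_mul (a := ENNReal.ofReal (Real.exp (-c * j) * (j + 1) ^ d))
      (hlim.comp hscale) (Or.inr ENNReal.ofReal_ne_top)
    rw [mul_zero] at h1
    refine h1.congr' ?_
    filter_upwards [self_mem_nhdsWithin] with r hr
    have hr : 0 < r := hr
    simp only [Function.comp]
    rw [← mul_assoc, ← mul_assoc, ← ENNReal.ofReal_mul (by positivity),
      ← ENNReal.ofReal_mul (by positivity)]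
    congr 2
    rw [mul_pow]
    field_simp
  have hsum : Tendsto (fun r : ℝ => ∑' j : ℕ, ENNReal.ofReal (Real.exp (-c * j)) *
      (ENNReal.ofReal (r ^ d)⁻¹ * ∫⁻ w in Metric.closedBall z ((j + 1) * r), g w ∂ν))
      (𝓝[>] 0) (𝓝 0) := by
    -- The limit is exchanged with the series by dominated convergence for the counting measure.
    have h1 := tendsto_lintegral_filter_of_dominated_convergence (μ := Measure.count)
      (l := 𝓝[>] (0 : ℝ)) (f := fun _ : ℕ => (0 : ℝ≥0∞))
      (F := fun (r : ℝ) (j : ℕ) => ENNReal.ofReal (Real.exp (-c * j)) *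
        (ENNReal.ofReal (r ^ d)⁻¹ * ∫⁻ w in Metric.closedBall z ((j + 1) * r), g w ∂ν))
      (fun j => ENNReal.ofReal (Real.exp (-c * j) * (b * ((j : ℝ) + 1) ^ d)))
      (Eventually.of_forall fun r => measurable_from_nat)
      (by
        filter_upwards [self_mem_nhdsWithin] with r hr
        refine ae_of_all _ fun j => ?_
        rw [ENNReal.ofReal_mul (Real.exp_pos _).le]
        gcongr
        exact scaled_setLIntegral_le hb hg1 hr j)
      (by
        rw [lintegral_count, ← ENNReal.ofReal_tsum_of_nonneg (fun j => by positivity)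
          (summable_exp_neg_mul_pow hc b d)]
        exact ENNReal.ofReal_ne_top)
      (ae_of_all _ hterm)
    simpa [lintegral_count] using h1
  refine tendsto_of_tendsto_of_tendsto_of_le_of_le' tendsto_const_nhds hsum
    (Eventually.of_forall fun _ => zero_le) ?_
  filter_upwards [self_mem_nhdsWithin] with r hr
  refine (mul_le_mul_right (lintegral_exp_neg_mul_le_tsum hc hr hg) _).trans (le_of_eq ?_)
  rw [← ENNReal.tsum_mul_left]
  exact tsum_congr fun j => mul_left_comm _ _ _

end gaussian

/-! ### Mass and mean oscillation of the kernel under the law. -/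

section moments

variable {d : ℕ} {ρ : (Fin (d + 1) → ℝ) → ℝ≥0} {L : ℝ≥0} {ν : Measure (Fin (d + 1) → ℝ)}

theorem openSimplex_subset_stdSimplex : openSimplex d ⊆ stdSimplex ℝ (Fin (d + 1)) :=
  fun _ hz => ⟨fun k => (hz.1 k).le, hz.2⟩

theorem tendsto_sqrt_nhdsGT_zero : Tendsto (fun h : ℝ => √h) (𝓝[>] 0) (𝓝[>] 0) := by
  refine tendsto_nhdsWithin_iff.2 ⟨?_, ?_⟩
  · have := (Real.continuous_sqrt.tendsto 0).mono_left (nhdsWithin_le_nhds (s := Set.Ioi 0))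
    simpa using this
  · filter_upwards [self_mem_nhdsWithin] with h hh
    exact Real.sqrt_pos.2 hh

theorem eventually_dirichletKernel_bound {z : Fin (d + 1) → ℝ} (hz : z ∈ openSimplex d) :
    ∃ C > 0, ∀ᶠ h in 𝓝[>] (0 : ℝ), ∀ w ∈ stdSimplex ℝ (Fin (d + 1)),
      dirichletKernel h z w ≤ C * (√h ^ d)⁻¹ := by
  obtain ⟨C, hC, c, hc, hle⟩ := exists_dirichletKernel_le hz
  refine ⟨C, hC, ?_⟩
  filter_upwards [Ioo_mem_nhdsGT (zero_lt_one (α := ℝ))] with h hh w hw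
  have h1 := hle h hh.1 hh.2.le w hw
  refine h1.trans ?_
  have h2 : Real.exp (-(c * (dist w z / √h) ^ 2)) ≤ 1 := Real.exp_le_one_iff.2 (by
    rw [neg_nonpos]; positivity)
  have h3 : 0 ≤ C * (√h ^ d)⁻¹ := by positivity
  exact mul_le_of_le_one_right h3 h2

/-- The kernel is a probability density in `z`, not in `w`, so its mass in `w` has to be bounded
through the Gaussian estimate. -/
theorem exists_lintegral_dirichletKernel_le
    (hρ : LipschitzOnWith L ρ (openSimplex d))
    (hν : ν = (simplexVolume d).withDensity (fun s => (ρ s : ℝ≥0∞)))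
    {z : Fin (d + 1) → ℝ} (hz : z ∈ openSimplex d) :
    ∃ C : ℝ, 0 ≤ C ∧ ∀ᶠ h in 𝓝[>] (0 : ℝ),
      ∫⁻ w, ENNReal.ofReal (dirichletKernel h z w) ∂ν ≤ ENNReal.ofReal C := by
  obtain ⟨C, hC, c, hc, hle⟩ := exists_dirichletKernel_le hz
  obtain ⟨b, hb0, hb⟩ := exists_withDensity_closedBall_le hρ
  rw [← hν] at hb
  have hmem : ∀ᵐ w ∂ν, w ∈ openSimplex d :=
    hν ▸ (ae_withDensity_mem_openSimplex hρ).mono fun _ h => h.1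
  refine ⟨C * ∑' j : ℕ, Real.exp (-c * j) * (b * ((j : ℝ) + 1) ^ d),
    mul_nonneg hC.le (tsum_nonneg fun j => by positivity), ?_⟩
  filter_upwards [Ioo_mem_nhdsGT (zero_lt_one (α := ℝ))] with h hh
  have h1 := scaled_lintegral_exp_le hc hb0 (hb z) (Real.sqrt_pos.2 hh.1)
  calc _ ≤ ∫⁻ w, ENNReal.ofReal C * (ENNReal.ofReal (√h ^ d)⁻¹ *
        ENNReal.ofReal (Real.exp (-(c * (dist w z / √h) ^ 2)))) ∂ν := by
        refine lintegral_mono_ae (hmem.mono fun w hw => ?_)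
        rw [← ENNReal.ofReal_mul (by positivity), ← ENNReal.ofReal_mul (by positivity), ← mul_assoc]
        exact ENNReal.ofReal_le_ofReal (hle h hh.1 hh.2.le w (openSimplex_subset_stdSimplex hw))
    _ ≤ _ := by
        rw [lintegral_const_mul' _ _ ENNReal.ofReal_ne_top,
          lintegral_const_mul' _ _ ENNReal.ofReal_ne_top, ENNReal.ofReal_mul hC.le]
        gcongr

/-- On the ball of radius `√h` alone the kernel is at least of order `√h ^ (-d)` while the ball has
mass at least of order `√h ^ d`. -/
theorem exists_le_lintegral_dirichletKernel
    (hρ : LipschitzOnWith L ρ (openSimplex d))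
    (hν : ν = (simplexVolume d).withDensity (fun s => (ρ s : ℝ≥0∞)))
    {z : Fin (d + 1) → ℝ} (hz : z ∈ openSimplex d)
    (hρz : 0 < ρ z) :
    ∃ a > 0, ∀ᶠ h in 𝓝[>] (0 : ℝ),
      ENNReal.ofReal a ≤ ∫⁻ w, ENNReal.ofReal (dirichletKernel h z w) ∂ν := by
  obtain ⟨c, hc, hle⟩ := exists_le_dirichletKernel hz
  obtain ⟨a, ha, hball⟩ := exists_le_withDensity_closedBall hρ hz hρz
  rw [← hν] at hball
  have hmem : ∀ᵐ w ∂ν, w ∈ openSimplex d :=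
    hν ▸ (ae_withDensity_mem_openSimplex hρ).mono fun _ h => h.1
  refine ⟨c * a, by positivity, ?_⟩
  filter_upwards [hle, tendsto_sqrt_nhdsGT_zero.eventually hball, self_mem_nhdsWithin]
    with h hk hb hh
  have hs : 0 < √h := Real.sqrt_pos.2 hh
  calc ENNReal.ofReal (c * a) = ENNReal.ofReal (c * (√h ^ d)⁻¹) * ENNReal.ofReal (a * √h ^ d) := by
        rw [← ENNReal.ofReal_mul (by positivity)]
        congr 1
        field_simp
    _ ≤ ENNReal.ofReal (c * (√h ^ d)⁻¹) * ν (Metric.closedBall z √h) := by gcongr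
    _ = ∫⁻ _ in Metric.closedBall z √h, ENNReal.ofReal (c * (√h ^ d)⁻¹) ∂ν := by
        rw [lintegral_const, Measure.restrict_apply_univ]
    _ ≤ ∫⁻ w in Metric.closedBall z √h, ENNReal.ofReal (dirichletKernel h z w) ∂ν := by
        refine lintegral_mono_ae ?_
        filter_upwards [ae_restrict_of_ae hmem,
          ae_restrict_mem Metric.isClosed_closedBall.measurableSet] with w hw hwr
        exact ENNReal.ofReal_le_ofReal (hk w (openSimplex_subset_stdSimplex hw) hwr)
    _ ≤ _ := setLIntegral_le_lintegral _ _

/-- At almost every point, the kernel-weighted mean oscillation of a bounded function vanishes in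
the limit. -/
theorem ae_tendsto_lintegral_dirichletKernel_mul [IsFiniteMeasure ν]
    (hρ : LipschitzOnWith L ρ (openSimplex d))
    (hν : ν = (simplexVolume d).withDensity (fun s => (ρ s : ℝ≥0∞)))
    {m : (Fin (d + 1) → ℝ) → ℝ}
    (hm : Measurable m) (hm01 : ∀ w, m w ∈ Set.Icc (0 : ℝ) 1) :
    ∀ᵐ z ∂ν, Tendsto (fun h : ℝ => ∫⁻ w, ENNReal.ofReal (dirichletKernel h z w) *
      ENNReal.ofReal |m w - m z| ∂ν) (𝓝[>] 0) (𝓝 0) := by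
  have hmem : ∀ᵐ w ∂ν, w ∈ openSimplex d :=
    hν ▸ (ae_withDensity_mem_openSimplex hρ).mono fun _ h => h.1
  obtain ⟨b, hb0, hb⟩ := exists_withDensity_closedBall_le hρ
  rw [← hν] at hb
  have hint : Integrable m ν := by
    refine Integrable.of_bound hm.aestronglyMeasurable 1 (ae_of_all _ fun w => ?_)
    rw [Real.norm_eq_abs, abs_of_nonneg (hm01 w).1]
    exact (hm01 w).2
  -- Almost every point is a Lebesgue point of `m` with respect to `ν` itself, by Besicovitch
  -- differentiation.
  filter_upwards [hmem, VitaliFamily.ae_tendsto_lintegral_enorm_sub_div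
    (v := Besicovitch.vitaliFamily ν) hint.locallyIntegrable] with z hz hleb
  obtain ⟨C, hC, c, hc, hle⟩ := exists_dirichletKernel_le hz
  have hleb := hleb.comp (Besicovitch.tendsto_filterAt ν z)
  set g : (Fin (d + 1) → ℝ) → ℝ≥0∞ := fun w => ENNReal.ofReal |m w - m z| with hg
  have hgm : Measurable g := by fun_prop
  have hg1 : ∀ w, g w ≤ 1 := fun w => by
    rw [hg, ENNReal.ofReal_le_one, abs_le]
    have h1 := hm01 w
    have h2 := hm01 z
    constructor <;> linarith [h1.1, h1.2, h2.1, h2.2]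
  -- Differentiation normalises by the mass of the ball; the upper bound on that mass allows
  -- normalising by `r ^ d` instead.
  have hlim : Tendsto (fun r : ℝ => ENNReal.ofReal (r ^ d)⁻¹ *
      ∫⁻ w in Metric.closedBall z r, g w ∂ν) (𝓝[>] 0) (𝓝 0) := by
    have h1 := ENNReal.Tendsto.const_mul (a := ENNReal.ofReal b) hleb
      (Or.inr ENNReal.ofReal_ne_top)
    rw [mul_zero] at h1
    refine tendsto_of_tendsto_of_tendsto_of_le_of_le' tendsto_const_nhds h1
      (Eventually.of_forall fun _ => zero_le) ?_
    filter_upwards [self_mem_nhdsWithin] with r hr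
    have hr : 0 < r := hr
    have hI : ∫⁻ w in Metric.closedBall z r, g w ∂ν =
        ∫⁻ w in Metric.closedBall z r, ‖m w - m z‖ₑ ∂ν :=
      lintegral_congr fun w => (Real.enorm_eq_ofReal_abs _).symm
    simp only [Function.comp]
    rw [← hI]
    set I := ∫⁻ w in Metric.closedBall z r, g w ∂ν with hIdef
    have hIle : I ≤ ν (Metric.closedBall z r) := by
      calc I ≤ ∫⁻ w in Metric.closedBall z r, 1 ∂ν := lintegral_mono hg1
        _ = _ := by simp
    rcases eq_or_ne (ν (Metric.closedBall z r)) 0 with h0 | h0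
    · have : I = 0 := by simpa [h0] using hIle
      simp [this]
    · have hfin : ν (Metric.closedBall z r) ≠ ∞ := measure_ne_top _ _
      have hbr : ENNReal.ofReal (r ^ d)⁻¹ * ν (Metric.closedBall z r) ≤ ENNReal.ofReal b := by
        refine (mul_le_mul_right (hb z r hr.le) _).trans (le_of_eq ?_)
        rw [← ENNReal.ofReal_mul (by positivity)]
        congr 1
        field_simp
      calc ENNReal.ofReal (r ^ d)⁻¹ * I
          = ENNReal.ofReal (r ^ d)⁻¹ * ν (Metric.closedBall z r) *
              (I / ν (Metric.closedBall z r)) := by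
            rw [mul_assoc, ENNReal.mul_div_cancel h0 hfin]
        _ ≤ _ := by gcongr
  have h2 := (tendsto_scaled_lintegral_exp_mul hc hb0 (hb z) hgm hg1 hlim).comp
    tendsto_sqrt_nhdsGT_zero
  have h3 := ENNReal.Tendsto.const_mul (a := ENNReal.ofReal C) h2 (Or.inr ENNReal.ofReal_ne_top)
  rw [mul_zero] at h3
  refine tendsto_of_tendsto_of_tendsto_of_le_of_le' tendsto_const_nhds h3
    (Eventually.of_forall fun _ => zero_le) ?_
  filter_upwards [Ioo_mem_nhdsGT (zero_lt_one (α := ℝ))] with h hh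
  simp only [Function.comp]
  rw [← lintegral_const_mul' _ _ ENNReal.ofReal_ne_top,
    ← lintegral_const_mul' _ _ ENNReal.ofReal_ne_top]
  refine lintegral_mono_ae (hmem.mono fun w hw => ?_)
  rw [← mul_assoc, ← mul_assoc]
  refine mul_le_mul_left ?_ _
  rw [← ENNReal.ofReal_mul hC.le, ← ENNReal.ofReal_mul (by positivity)]
  exact ENNReal.ofReal_le_ofReal (hle h hh.1 hh.2.le w (openSimplex_subset_stdSimplex hw))

end moments

/-! ### Mean error of ratio estimators. -/

/-- Deviation bound for a ratio estimator: `D` is a sum of `N` weights with mean `a`, `S` the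
corresponding weighted sum of numbers in `[0, 1]`, and `S - m D` has mean `N β`. -/
theorem abs_inv_mul_sub_le {D S m a β N δ : ℝ} (hS0 : 0 ≤ S) (hSD : S ≤ D)
    (hm : m ∈ Set.Icc (0 : ℝ) 1) (ha : 0 < a) (hN : 0 < N) (hδ : 0 < δ) :
    |D⁻¹ * S - m| ≤ 2 * |β| / a + δ / a + (S - m * D - N * β) ^ 2 / (δ * a * N ^ 2)
      + 4 * (D - N * a) ^ 2 / (N * a) ^ 2 := by
  have hNa : 0 < N * a := by positivity
  -- If `D` reaches half its mean, it can be replaced by `N * a / 2` in the denominator. Otherwise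
  -- the error is at most `1`, which the last term, the squared deviation of `D`, already exceeds.
  rcases le_or_gt (N * a / 2) D with h | h
  · have hD : 0 < D := by linarith
    have h1 : |D⁻¹ * S - m| = |S - m * D| / D := by
      rw [← abs_of_pos hD, ← abs_div, abs_of_pos hD]
      congr 1
      field_simp
    have h2 : |S - m * D| / D ≤ |S - m * D| / (N * a / 2) := by gcongr
    have h3 : |S - m * D| ≤ |S - m * D - N * β| + N * |β| := by
      have := abs_add_le (S - m * D - N * β) (N * β)
      rwa [abs_mul, abs_of_pos hN, sub_add_cancel] at this
    -- The arithmetic-geometric inequality with a free weight `δ` trades the absolute deviation for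
    -- a square, whose mean is a variance.
    have h4 : |S - m * D - N * β| ≤ δ * N / 2 + (S - m * D - N * β) ^ 2 / (2 * (δ * N)) := by
      have hp : 0 < δ * N := by positivity
      rw [← sq_abs (S - m * D - N * β)]
      generalize |S - m * D - N * β| = t
      rw [div_add_div _ _ (by norm_num) (by positivity), le_div_iff₀ (by positivity)]
      nlinarith [sq_nonneg (δ * N - t)]
    have h5 : |S - m * D| / (N * a / 2) ≤
        (δ * N / 2 + (S - m * D - N * β) ^ 2 / (2 * (δ * N)) + N * |β|) / (N * a / 2) := by
      gcongr
      linarith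
    have h6 : (δ * N / 2 + (S - m * D - N * β) ^ 2 / (2 * (δ * N)) + N * |β|) / (N * a / 2) =
        2 * |β| / a + δ / a + (S - m * D - N * β) ^ 2 / (δ * a * N ^ 2) := by
      field_simp
      ring
    have h7 : 0 ≤ 4 * (D - N * a) ^ 2 / (N * a) ^ 2 := by positivity
    linarith
  · have hD0 : 0 ≤ D := hS0.trans hSD
    have h1 : |D⁻¹ * S - m| ≤ 1 := by
      have h2 : 0 ≤ D⁻¹ * S := by positivity
      have h3 : D⁻¹ * S ≤ 1 := by
        rw [← div_eq_inv_mul]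
        exact div_le_one_of_le₀ hSD hD0
      rw [abs_le]
      constructor <;> linarith [hm.1, hm.2]
    have h2 : 1 ≤ 4 * (D - N * a) ^ 2 / (N * a) ^ 2 := by
      rw [le_div_iff₀ (by positivity)]
      nlinarith
    have h3 : 0 ≤ 2 * |β| / a + δ / a + (S - m * D - N * β) ^ 2 / (δ * a * N ^ 2) := by positivity
    linarith

/-- A weighted mean of numbers in `[0, 1]` stays in `[0, 1]`; the convention `0⁻¹ = 0` covers
vanishing total weight. -/
theorem abs_inv_sum_mul_sum_sub_le_one {ι : Type*} {s : Finset ι} {u t : ι → ℝ}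
    (hu : ∀ i ∈ s, 0 ≤ u i) (ht : ∀ i ∈ s, t i ∈ Set.Icc (0 : ℝ) 1) {m : ℝ}
    (hm : m ∈ Set.Icc (0 : ℝ) 1) : |(∑ i ∈ s, u i)⁻¹ * ∑ i ∈ s, u i * t i - m| ≤ 1 := by
  have h1 : 0 ≤ ∑ i ∈ s, u i := Finset.sum_nonneg hu
  have h2 : 0 ≤ ∑ i ∈ s, u i * t i := Finset.sum_nonneg fun i hi => mul_nonneg (hu i hi) (ht i hi).1
  have h3 : ∑ i ∈ s, u i * t i ≤ ∑ i ∈ s, u i :=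
    Finset.sum_le_sum fun i hi => mul_le_of_le_one_right (hu i hi) (ht i hi).2
  have h4 : 0 ≤ (∑ i ∈ s, u i)⁻¹ * ∑ i ∈ s, u i * t i := by positivity
  have h5 : (∑ i ∈ s, u i)⁻¹ * ∑ i ∈ s, u i * t i ≤ 1 := by
    rw [← div_eq_inv_mul]
    exact div_le_one_of_le₀ h3 h1
  rw [abs_le]
  constructor <;> linarith [hm.1, hm.2]

section ratio

variable {Ω : Type*} [MeasurableSpace Ω] {P : Measure Ω} [IsProbabilityMeasure P]

/-- Pairwise independence makes the variance additive, and each variance is at most the second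
moment. -/
theorem integral_sq_sum_sub_le {U : ℕ → Ω → ℝ} (hU : ∀ i, Measurable (U i))
    {B : ℝ} (hB : ∀ i ω, |U i ω| ≤ B) (hind : Pairwise fun i j => IndepFun (U i) (U j) P)
    {u M : ℝ} (hu : ∀ i, ∫ ω, U i ω ∂P = u) (hM : ∀ i, ∫ ω, U i ω ^ 2 ∂P ≤ M) (s : Finset ℕ) :
    ∫ ω, (∑ i ∈ s, U i ω - s.card * u) ^ 2 ∂P ≤ s.card * M := by
  have hL : ∀ i, MemLp (U i) 2 P := fun i =>
    MemLp.of_bound (hU i).aestronglyMeasurable B (ae_of_all _ (hB i))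
  have h1 := IndepFun.variance_sum (X := U) (s := s) (μ := P) (fun i _ => hL i)
    (fun i _ j _ hij => hind hij)
  have hsum : (∑ i ∈ s, U i) = fun ω => ∑ i ∈ s, U i ω := by
    ext ω
    simp
  rw [variance_eq_integral
    (hsum ▸ (Finset.measurable_sum s fun i _ => hU i).aemeasurable)] at h1
  have h2 : ∫ ω, (∑ i ∈ s, U i) ω ∂P = s.card * u := by
    simp only [Finset.sum_apply]
    rw [integral_finsetSum s fun i _ => (hL i).integrable (by norm_num)]
    simp [hu]
  rw [h2] at h1
  simp only [Finset.sum_apply] at h1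
  rw [h1]
  refine (Finset.sum_le_sum fun i _ => ?_).trans (by rw [Finset.sum_const, nsmul_eq_mul])
  exact (variance_le_expectation_sq (hU i).aestronglyMeasurable).trans (hM i)

/-- Mean error of a ratio estimator built from pairwise independent observations. -/
theorem integral_abs_ratio_sub_le {𝒲 : Type*} [MeasurableSpace 𝒲] {V : ℕ → Ω → 𝒲}
    (hV : ∀ i, Measurable (V i)) (hind : Pairwise fun i j => IndepFun (V i) (V j) P)
    {φ ψ : 𝒲 → ℝ} (hφm : Measurable φ) (hψm : Measurable ψ) {B : ℝ}
    (hφ : ∀ i ω, φ (V i ω) ∈ Set.Icc 0 B) (hψ : ∀ v, ψ v ∈ Set.Icc (0 : ℝ) 1) {m a β M δ : ℝ}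
    (hm : m ∈ Set.Icc (0 : ℝ) 1) (ha : 0 < a) (hδ : 0 < δ) (hφa : ∀ i, ∫ ω, φ (V i ω) ∂P = a)
    (hβ : ∀ i, ∫ ω, φ (V i ω) * (ψ (V i ω) - m) ∂P = β) (hM : ∀ i, ∫ ω, φ (V i ω) ^ 2 ∂P ≤ M)
    {s : Finset ℕ} (hs : s.Nonempty) :
    ∫ ω, |(∑ i ∈ s, φ (V i ω))⁻¹ * ∑ i ∈ s, φ (V i ω) * ψ (V i ω) - m| ∂P ≤
      2 * |β| / a + δ / a + M / (δ * a * s.card) + 4 * M / (s.card * a ^ 2) := by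
  set N : ℝ := (s.card : ℝ) with hNdef
  have hN : 0 < N := by rw [hNdef]; exact_mod_cast hs.card_pos
  have hB1 : ∀ i ω, |φ (V i ω)| ≤ B := fun i ω => by
    rw [abs_of_nonneg (hφ i ω).1]; exact (hφ i ω).2
  have hη : ∀ i ω, |φ (V i ω) * (ψ (V i ω) - m)| ≤ |φ (V i ω)| := fun i ω => by
    rw [abs_mul]
    refine mul_le_of_le_one_right (abs_nonneg _) ?_
    rw [abs_le]
    constructor <;> linarith [(hψ (V i ω)).1, (hψ (V i ω)).2, hm.1, hm.2]
  have hmφ : ∀ i, Measurable fun ω => φ (V i ω) := fun i => hφm.comp (hV i)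
  have hmη : ∀ i, Measurable fun ω => φ (V i ω) * (ψ (V i ω) - m) := fun i =>
    (hmφ i).mul ((hψm.comp (hV i)).sub_const m)
  have hM2 : ∀ i, ∫ ω, (φ (V i ω) * (ψ (V i ω) - m)) ^ 2 ∂P ≤ M := fun i => by
    refine le_trans (integral_mono_of_nonneg (ae_of_all _ fun ω => sq_nonneg _) ?_
      (ae_of_all _ fun ω => sq_le_sq.2 (hη i ω))) (hM i)
    refine Integrable.of_bound ((hmφ i).pow_const 2).aestronglyMeasurable (B ^ 2)
      (ae_of_all _ fun ω => ?_)
    rw [norm_pow]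
    exact pow_le_pow_left₀ (norm_nonneg _) (hB1 i ω) 2
  have v1 := integral_sq_sum_sub_le hmφ hB1 (fun i j hij => (hind hij).comp hφm hφm) hφa hM s
  have v2 := integral_sq_sum_sub_le hmη (fun i ω => (hη i ω).trans (hB1 i ω))
    (fun i j hij => (hind hij).comp (φ := fun v => φ v * (ψ v - m))
      (ψ := fun v => φ v * (ψ v - m)) (hφm.mul (hψm.sub_const m)) (hφm.mul (hψm.sub_const m)))
    hβ hM2 s
  have bdd : ∀ (U : ℕ → Ω → ℝ), (∀ i, Measurable (U i)) → (∀ i ω, |U i ω| ≤ B) → ∀ u : ℝ,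
      Integrable (fun ω => (∑ i ∈ s, U i ω - N * u) ^ 2) P := fun U hU hUB u => by
    refine Integrable.of_bound (((Finset.measurable_sum s fun i _ => hU i).sub_const
      _).pow_const 2).aestronglyMeasurable ((N * B + |N * u|) ^ 2) (ae_of_all _ fun ω => ?_)
    rw [norm_pow]
    refine pow_le_pow_left₀ (norm_nonneg _) ?_ 2
    refine (norm_sub_le _ _).trans (add_le_add ?_ le_rfl)
    refine (norm_sum_le _ _).trans ((Finset.sum_le_sum fun i _ => hUB i ω).trans (le_of_eq ?_))
    rw [Finset.sum_const, nsmul_eq_mul]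
  have i1 := bdd _ hmφ hB1 a
  have i2 := bdd _ hmη (fun i ω => (hη i ω).trans (hB1 i ω)) β
  have hpt : ∀ ω, |(∑ i ∈ s, φ (V i ω))⁻¹ * ∑ i ∈ s, φ (V i ω) * ψ (V i ω) - m| ≤
      2 * |β| / a + δ / a
        + (∑ i ∈ s, φ (V i ω) * (ψ (V i ω) - m) - N * β) ^ 2 * (δ * a * N ^ 2)⁻¹
        + (∑ i ∈ s, φ (V i ω) - N * a) ^ 2 * (4 * ((N * a) ^ 2)⁻¹) := fun ω => by
    have h1 := abs_inv_mul_sub_le (D := ∑ i ∈ s, φ (V i ω)) (S := ∑ i ∈ s, φ (V i ω) * ψ (V i ω))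
      (β := β) (Finset.sum_nonneg fun i _ => mul_nonneg (hφ i ω).1 (hψ _).1)
      (Finset.sum_le_sum fun i _ => mul_le_of_le_one_right (hφ i ω).1 (hψ _).2) hm ha hN hδ
    refine h1.trans (le_of_eq ?_)
    have h2 : ∑ i ∈ s, φ (V i ω) * (ψ (V i ω) - m) =
        ∑ i ∈ s, φ (V i ω) * ψ (V i ω) - m * ∑ i ∈ s, φ (V i ω) := by
      rw [Finset.mul_sum, ← Finset.sum_sub_distrib]
      exact Finset.sum_congr rfl fun i _ => by ring
    rw [h2]
    ring
  have j1 := i1.mul_const (4 * ((N * a) ^ 2)⁻¹)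
  have j2 := i2.mul_const (δ * a * N ^ 2)⁻¹
  refine (integral_mono_of_nonneg (ae_of_all _ fun ω => abs_nonneg _)
    (((integrable_const _).add j2).add j1) (ae_of_all _ hpt)).trans ?_
  rw [integral_add' ((integrable_const _).add j2) j1, integral_add' (integrable_const _) j2,
    integral_mul_const, integral_mul_const]
  simp only [integral_const, probReal_univ, smul_eq_mul, one_mul]
  have k1 : (∫ ω, (∑ i ∈ s, φ (V i ω) - N * a) ^ 2 ∂P) * (4 * ((N * a) ^ 2)⁻¹) ≤
      N * M * (4 * ((N * a) ^ 2)⁻¹) := by gcongr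
  have k2 : (∫ ω, (∑ i ∈ s, φ (V i ω) * (ψ (V i ω) - m) - N * β) ^ 2 ∂P) *
      (δ * a * N ^ 2)⁻¹ ≤ N * M * (δ * a * N ^ 2)⁻¹ := by gcongr
  have k3 : N * M * (4 * ((N * a) ^ 2)⁻¹) = 4 * M / (N * a ^ 2) := by field_simp
  have k4 : N * M * (δ * a * N ^ 2)⁻¹ = M / (δ * a * N) := by field_simp
  linarith

end ratio

/-! ### Error of the kernel-weighted label frequencies. -/

theorem oneHot_mem_Icc {d : ℕ} (y k : Fin (d + 1)) : oneHot y k ∈ Set.Icc (0 : ℝ) 1 := by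
  unfold oneHot
  rw [Pi.single_apply]
  split_ifs <;> simp

/-- The absolute error of the kernel-weighted label frequency at `z`. -/
noncomputable def labelError {d : ℕ} {ι : Type*} (h : ℝ) (m : (Fin (d + 1) → ℝ) → ℝ)
    (k : Fin (d + 1)) (s : Finset ι) (z : Fin (d + 1) → ℝ)
    (v : ι → (Fin (d + 1) → ℝ) × Fin (d + 1)) : ℝ :=
  |(∑ i ∈ s, dirichletKernel h z (v i).1)⁻¹ *
    ∑ i ∈ s, dirichletKernel h z (v i).1 * oneHot (v i).2 k - m z|

section labelError

variable {d : ℕ} {h : ℝ} {m : (Fin (d + 1) → ℝ) → ℝ} {k : Fin (d + 1)}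

theorem labelError_nonneg {ι : Type*} (s : Finset ι) (z : Fin (d + 1) → ℝ)
    (v : ι → (Fin (d + 1) → ℝ) × Fin (d + 1)) : 0 ≤ labelError h m k s z v := abs_nonneg _

theorem labelError_le_one {ι : Type*} (hh : 0 < h) (hm01 : ∀ w, m w ∈ Set.Icc (0 : ℝ) 1)
    (s : Finset ι) {z : Fin (d + 1) → ℝ} (hz : z ∈ stdSimplex ℝ (Fin (d + 1)))
    (v : ι → (Fin (d + 1) → ℝ) × Fin (d + 1)) (hv : ∀ i, (v i).1 ∈ stdSimplex ℝ (Fin (d + 1))) :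
    labelError h m k s z v ≤ 1 :=
  abs_inv_sum_mul_sum_sub_le_one (fun i _ => dirichletKernel_nonneg hh hz (hv i))
    (fun _ _ => oneHot_mem_Icc _ k) (hm01 z)

theorem measurable_labelError {ι : Type*} (hm : Measurable m) (s : Finset ι) :
    Measurable fun q : (Fin (d + 1) → ℝ) × (ι → (Fin (d + 1) → ℝ) × Fin (d + 1)) =>
      labelError h m k s q.1 q.2 := by
  have hK : ∀ i : ι, Measurable
      fun q : (Fin (d + 1) → ℝ) × (ι → (Fin (d + 1) → ℝ) × Fin (d + 1)) =>
        dirichletKernel h q.1 (q.2 i).1 := fun i =>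
    (measurable_dirichletKernel h).comp
      (f := fun q : (Fin (d + 1) → ℝ) × (ι → (Fin (d + 1) → ℝ) × Fin (d + 1)) => (q.1, (q.2 i).1))
      (by fun_prop)
  have hO : ∀ i : ι, Measurable
      fun q : (Fin (d + 1) → ℝ) × (ι → (Fin (d + 1) → ℝ) × Fin (d + 1)) =>
        (oneHot (q.2 i).2 k : ℝ) := fun i =>
    (measurable_of_countable fun y : Fin (d + 1) => (oneHot y k : ℝ)).comp
      (f := fun q : (Fin (d + 1) → ℝ) × (ι → (Fin (d + 1) → ℝ) × Fin (d + 1)) => (q.2 i).2)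
      (by fun_prop)
  have h1 := Finset.measurable_sum s fun i _ => hK i
  have h2 := Finset.measurable_sum s fun i _ => (hK i).mul (hO i)
  exact ((h1.inv.mul h2).sub (hm.comp measurable_fst)).abs

end labelError

/-! ### From fixed evaluation points to leave-one-out evaluation. -/

section sample

variable {Ω : Type*} [MeasurableSpace Ω] {P : Measure Ω} [IsProbabilityMeasure P] {d : ℕ}
  {Z : ℕ → Ω → Fin (d + 1) → ℝ} {Y : ℕ → Ω → Fin (d + 1)}
  {ν : Measure (Fin (d + 1) → ℝ)} {ρ : (Fin (d + 1) → ℝ) → ℝ≥0} {L : ℝ≥0}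
  {m : (Fin (d + 1) → ℝ) → ℝ} {k : Fin (d + 1)} {h : ℕ → ℝ}

/-- Mean error of the kernel-weighted label frequency at `z`, in terms of a bound `B` of the kernel,
bounds `a`, `C` of its mean and its mean oscillation at `z`. -/
theorem integral_labelError_le (hZ : ∀ i, Measurable (Z i))
    (hY : ∀ i, Measurable (Y i)) (hZs : ∀ i ω, Z i ω ∈ stdSimplex ℝ (Fin (d + 1)))
    (hind : Pairwise fun i j => IndepFun (fun ω => (Z i ω, Y i ω)) (fun ω => (Z j ω, Y j ω)) P)
    (hlaw : ∀ i, P.map (Z i) = ν)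
    (hm : Measurable m) (hm01 : ∀ w, m w ∈ Set.Icc (0 : ℝ) 1)
    (hmk : ∀ i, ∀ u : (Fin (d + 1) → ℝ) → ℝ, Measurable u → (∃ B, ∀ ω, |u (Z i ω)| ≤ B) →
      ∫ ω, u (Z i ω) * oneHot (Y i ω) k ∂P = ∫ ω, u (Z i ω) * m (Z i ω) ∂P)
    {η : ℝ} (hη : 0 < η) {z : Fin (d + 1) → ℝ} (hz : z ∈ openSimplex d) {a B C δ : ℝ}
    (hmem : ∀ᵐ w ∂ν, w ∈ openSimplex d)
    (ha : 0 < a) (hC₂ : 0 ≤ C) (hδ0 : 0 < δ)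
    (hB : ∀ w ∈ stdSimplex ℝ (Fin (d + 1)), dirichletKernel η z w ≤ B)
    (hup : ∫⁻ w, ENNReal.ofReal (dirichletKernel η z w) ∂ν ≤ ENNReal.ofReal C)
    (hlow : ENNReal.ofReal a ≤ ∫⁻ w, ENNReal.ofReal (dirichletKernel η z w) ∂ν)
    (hfin : ∫⁻ w, ENNReal.ofReal (dirichletKernel η z w) * ENNReal.ofReal |m w - m z| ∂ν ≠ ∞)
    {s : Finset ℕ} (hsne : s.Nonempty) :
    ∫ ω, labelError η m k s z (fun i => (Z i ω, Y i ω)) ∂P ≤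
      2 * (∫⁻ w, ENNReal.ofReal (dirichletKernel η z w) *
        ENNReal.ofReal |m w - m z| ∂ν).toReal / a + δ / a + B * C / (δ * a * s.card)
        + 4 * (B * C) / (s.card * a ^ 2) := by
  have hzs := openSimplex_subset_stdSimplex hz
  obtain ⟨K, hK⟩ : ∃ K : (Fin (d + 1) → ℝ) → ℝ, ∀ w, dirichletKernel η z w = K w :=
    ⟨_, fun _ => rfl⟩
  have hKm : Measurable K := by
    rw [← funext hK]
    exact (measurable_dirichletKernel η).comp (f := fun w => (z, w)) measurable_prodMk_left
  have hKs : ∀ w ∈ stdSimplex ℝ (Fin (d + 1)), 0 ≤ K w := fun w hw =>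
    hK w ▸ dirichletKernel_nonneg hη hzs hw
  simp only [labelError, hK] at hB hup hlow hfin ⊢
  obtain ⟨b, hb⟩ : ∃ b, (∫⁻ w, ENNReal.ofReal (K w) *
    ENNReal.ofReal |m w - m z| ∂ν).toReal = b := ⟨_, rfl⟩
  rw [hb]
  have hB0 : 0 ≤ B := (hKs z hzs).trans (hB z hzs)
  have hK0 : ∀ i ω, 0 ≤ K (Z i ω) := fun i ω => hKs _ (hZs i ω)
  have hKB : ∀ i ω, K (Z i ω) ≤ B := fun i ω => hB _ (hZs i ω)
  have hKabs : ∀ i ω, |K (Z i ω)| ≤ B := fun i ω => by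
    rw [abs_of_nonneg (hK0 i ω)]; exact hKB i ω
  have hKint : ∀ i, Integrable (fun ω => K (Z i ω)) P := fun i =>
    Integrable.of_bound (hKm.comp (hZ i)).aestronglyMeasurable _ (ae_of_all _ (hKabs i))
  set A := (∫⁻ w, ENNReal.ofReal (K w) ∂ν).toReal with hA
  have hAi : ∀ i, ∫ ω, K (Z i ω) ∂P = A := fun i => by
    rw [integral_eq_lintegral_of_nonneg_ae (ae_of_all _ (hK0 i))
      (hKm.comp (hZ i)).aestronglyMeasurable, hA, ← hlaw i,
      lintegral_map hKm.ennreal_ofReal (hZ i)]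
  have haA : a ≤ A := by
    rw [hA, ← ENNReal.ofReal_le_iff_le_toReal (ne_top_of_le_ne_top ENNReal.ofReal_ne_top hup)]
    exact hlow
  have hAC : A ≤ C := ENNReal.toReal_le_of_le_ofReal hC₂ hup
  have hA0 : 0 < A := ha.trans_le haA
  -- Bounding the second moment by supremum times mean yields one factor `√h ^ (-d)` rather than
  -- two, which is what the bandwidth rate can absorb.
  have hM : ∀ i, ∫ ω, K (Z i ω) ^ 2 ∂P ≤ B * C := fun i => by
    calc ∫ ω, K (Z i ω) ^ 2 ∂P ≤ ∫ ω, B * K (Z i ω) ∂P := by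
          refine integral_mono_of_nonneg (ae_of_all _ fun ω => sq_nonneg _)
            ((hKint i).const_mul _) (ae_of_all _ fun ω => ?_)
          simp only
          rw [sq]
          exact mul_le_mul_of_nonneg_right (hKB i ω) (hK0 i ω)
      _ = B * A := by rw [integral_const_mul, hAi]
      _ ≤ _ := by gcongr
  set β := ∫ w, K w * (m w - m z) ∂ν with hβdef
  have hmm : ∀ i, Integrable (fun ω => K (Z i ω) * m (Z i ω)) P := fun i => by
    refine (hKint i).mono' ((hKm.comp (hZ i)).mul (hm.comp (hZ i))).aestronglyMeasurable
      (ae_of_all _ fun ω => ?_)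
    rw [Real.norm_eq_abs, abs_mul, abs_of_nonneg (hK0 i ω), abs_of_nonneg (hm01 _).1]
    exact mul_le_of_le_one_right (hK0 i ω) (hm01 _).2
  have hmo : Measurable fun y : Fin (d + 1) => (oneHot y k : ℝ) := measurable_of_countable _
  have hom : ∀ i, Integrable (fun ω => K (Z i ω) * oneHot (Y i ω) k) P := fun i => by
    refine (hKint i).mono' ((hKm.comp (hZ i)).mul (hmo.comp (hY i))).aestronglyMeasurable
      (ae_of_all _ fun ω => ?_)
    rw [Real.norm_eq_abs, abs_mul, abs_of_nonneg (hK0 i ω), abs_of_nonneg (oneHot_mem_Icc _ k).1]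
    exact mul_le_of_le_one_right (hK0 i ω) (oneHot_mem_Icc _ k).2
  have hβi : ∀ i, ∫ ω, K (Z i ω) * (oneHot (Y i ω) k - m z) ∂P = β := fun i => by
    simp_rw [mul_sub]
    rw [integral_sub (hom i) ((hKint i).mul_const _), hmk i K hKm ⟨_, hKabs i⟩,
      ← integral_sub (hmm i) ((hKint i).mul_const _), hβdef, ← hlaw i,
      integral_map (hZ i).aemeasurable (f := fun w => K w * (m w - m z))
        (hKm.mul (hm.sub_const _)).aestronglyMeasurable]
    simp_rw [mul_sub]
  have hβb : |β| ≤ b := by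
    rw [hβdef, ← hb, ← Real.norm_eq_abs]
    refine (norm_integral_le_lintegral_norm _).trans (ENNReal.toReal_mono hfin ?_)
    refine lintegral_mono_ae (hmem.mono fun w hw => ?_)
    have hKw : 0 ≤ K w := hKs w (openSimplex_subset_stdSimplex hw)
    rw [norm_mul, Real.norm_eq_abs, abs_of_nonneg hKw, ENNReal.ofReal_mul hKw, Real.norm_eq_abs]
  have key := integral_abs_ratio_sub_le (P := P) (V := fun i ω => (Z i ω, Y i ω))
    (fun i => (hZ i).prodMk (hY i)) hind (φ := fun v => K v.1) (ψ := fun v => oneHot v.2 k)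
    (hKm.comp measurable_fst) (hmo.comp measurable_snd) (B := B)
    (fun i ω => ⟨hK0 i ω, hKB i ω⟩) (fun v => oneHot_mem_Icc _ k) (hm01 z) hA0 hδ0 hAi hβi hM hsne
  refine key.trans ?_
  have hN : (0 : ℝ) < s.card := by exact_mod_cast hsne.card_pos
  have hb0 : 0 ≤ b := (abs_nonneg _).trans hβb
  gcongr

/-- Consistency of the kernel-weighted label frequency at almost every point, uniformly in the
index set of the sample. -/
theorem ae_eventually_integral_labelError_le (hZ : ∀ i, Measurable (Z i))
    (hY : ∀ i, Measurable (Y i)) (hZs : ∀ i ω, Z i ω ∈ stdSimplex ℝ (Fin (d + 1)))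
    (hind : Pairwise fun i j => IndepFun (fun ω => (Z i ω, Y i ω)) (fun ω => (Z j ω, Y j ω)) P)
    (hlaw : ∀ i, P.map (Z i) = ν) (hρ : LipschitzOnWith L ρ (openSimplex d))
    (hν : ν = (simplexVolume d).withDensity (fun s => (ρ s : ℝ≥0∞)))
    (hm : Measurable m) (hm01 : ∀ w, m w ∈ Set.Icc (0 : ℝ) 1)
    (hmk : ∀ i, ∀ u : (Fin (d + 1) → ℝ) → ℝ, Measurable u → (∃ B, ∀ ω, |u (Z i ω)| ≤ B) →
      ∫ ω, u (Z i ω) * oneHot (Y i ω) k ∂P = ∫ ω, u (Z i ω) * m (Z i ω) ∂P)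
    (hpos : ∀ n, 0 < h n) (hzero : Tendsto h atTop (𝓝 0))
    (hrate : Tendsto (fun n : ℕ => (n : ℝ) * √(h n) ^ d) atTop atTop) :
    ∀ᵐ z ∂ν, ∀ ε > 0, ∀ᶠ n in atTop, ∀ s : Finset ℕ, s.card + 1 = n →
      ∫ ω, labelError (h n) m k s z (fun i => (Z i ω, Y i ω)) ∂P ≤ ε := by
  have hprob : IsProbabilityMeasure ν :=
    hlaw 0 ▸ Measure.isProbabilityMeasure_map (hZ 0).aemeasurable
  have hh0 : Tendsto h atTop (𝓝[>] 0) :=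
    tendsto_nhdsWithin_iff.2 ⟨hzero, Eventually.of_forall hpos⟩
  filter_upwards [hν ▸ ae_withDensity_mem_openSimplex hρ,
    ae_tendsto_lintegral_dirichletKernel_mul hρ hν hm hm01] with z ⟨hz, hρz⟩ hosc ε hε
  obtain ⟨C₁, hC₁, hbd⟩ := eventually_dirichletKernel_bound hz
  obtain ⟨C₂, hC₂, hup⟩ := exists_lintegral_dirichletKernel_le hρ hν hz
  obtain ⟨a, ha, hlow⟩ := exists_le_lintegral_dirichletKernel hρ hν hz hρz
  have hosc' : Tendsto (fun n => (∫⁻ w, ENNReal.ofReal (dirichletKernel (h n) z w) *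
      ENNReal.ofReal |m w - m z| ∂ν).toReal) atTop (𝓝 0) := by
    have := (ENNReal.tendsto_toReal ENNReal.zero_ne_top).comp (hosc.comp hh0)
    simpa [Function.comp_def] using this
  set b : ℕ → ℝ := fun n => (∫⁻ w, ENNReal.ofReal (dirichletKernel (h n) z w) *
      ENNReal.ofReal |m w - m z| ∂ν).toReal with hb
  -- With this choice the term `δ / a` equals `ε / 2`; the other terms tend to zero with `δ` fixed.
  set δ := ε * a / 2 with hδ
  have hδ0 : 0 < δ := by positivity
  have hlim : Tendsto (fun n : ℕ => 2 * b n / a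
      + (2 * (C₁ * C₂) / (δ * a) + 8 * (C₁ * C₂) / a ^ 2) * ((n : ℝ) * √(h n) ^ d)⁻¹)
      atTop (𝓝 0) := by
    have h1 := (hosc'.const_mul 2).div_const a
    have h2 := (tendsto_inv_atTop_zero.comp hrate).const_mul
      (2 * (C₁ * C₂) / (δ * a) + 8 * (C₁ * C₂) / a ^ 2)
    simpa using h1.add h2
  filter_upwards [hh0.eventually hbd, hh0.eventually hup, hh0.eventually hlow,
    hlim.eventually (gt_mem_nhds (half_pos hε)), eventually_ge_atTop 2,
    (hosc.comp hh0).eventually (gt_mem_nhds ENNReal.zero_lt_top)]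
    with n hbd hup hlow hsmall hn2 hfin s hs
  have hsne : s.Nonempty := by
    rw [← Finset.card_pos]; omega
  have hmem : ∀ᵐ w ∂ν, w ∈ openSimplex d :=
    hν ▸ (ae_withDensity_mem_openSimplex hρ).mono fun _ h => h.1
  refine (integral_labelError_le hZ hY hZs hind hlaw hm hm01 hmk (hpos n) hz hmem ha hC₂ hδ0
    hbd hup hlow hfin.ne hsne).trans ?_
  have hq : 0 < √(h n) ^ d := pow_pos (Real.sqrt_pos.2 (hpos n)) d
  have hN : (n : ℝ) / 2 ≤ s.card := by
    have h1 : (s.card : ℝ) + 1 = n := by exact_mod_cast hs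
    have h2 : (2 : ℝ) ≤ n := by exact_mod_cast hn2
    linarith
  have hn0 : (0 : ℝ) < n := by
    have h2 : (2 : ℝ) ≤ n := by exact_mod_cast hn2
    linarith
  have t2 : δ / a = ε / 2 := by
    rw [hδ]; field_simp
  have t3 : C₁ * (√(h n) ^ d)⁻¹ * C₂ / (δ * a * s.card) ≤
      2 * (C₁ * C₂) / (δ * a) * ((n : ℝ) * √(h n) ^ d)⁻¹ := by
    calc _ ≤ C₁ * (√(h n) ^ d)⁻¹ * C₂ / (δ * a * (n / 2)) := by gcongr
      _ = _ := by field_simp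
  have t4 : 4 * (C₁ * (√(h n) ^ d)⁻¹ * C₂) / (s.card * a ^ 2) ≤
      8 * (C₁ * C₂) / a ^ 2 * ((n : ℝ) * √(h n) ^ d)⁻¹ := by
    calc _ ≤ 4 * (C₁ * (√(h n) ^ d)⁻¹ * C₂) / (n / 2 * a ^ 2) := by gcongr
      _ = _ := by field_simp; ring
  rw [add_mul] at hsmall
  linarith

/-- The error at an observation independent of the sample is an average of the errors at fixed
points. -/
theorem integral_labelError_eq (hZ : ∀ i, Measurable (Z i)) (hY : ∀ i, Measurable (Y i))
    (hZs : ∀ i ω, Z i ω ∈ stdSimplex ℝ (Fin (d + 1)))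
    (hind : iIndepFun (fun i ω => (Z i ω, Y i ω)) P) (hlaw : ∀ i, P.map (Z i) = ν)
    (hm : Measurable m) (hm01 : ∀ w, m w ∈ Set.Icc (0 : ℝ) 1) {η : ℝ} (hη : 0 < η)
    {s : Finset ℕ} {j : ℕ} (hj : j ∉ s) :
    ∫ ω, labelError η m k s (Z j ω) (fun i => (Z i ω, Y i ω)) ∂P =
      ∫ z, ∫ ω, labelError η m k s z (fun i => (Z i ω, Y i ω)) ∂P ∂ν := by
  have hV : ∀ i, Measurable fun ω => (Z i ω, Y i ω) := fun i => (hZ i).prodMk (hY i)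
  -- Only the observations indexed by `s` enter the error, so independence of `Z j` is needed only
  -- from this finite subfamily.
  set W : Ω → (s → (Fin (d + 1) → ℝ) × Fin (d + 1)) := fun ω i => (Z i ω, Y i ω) with hW
  have hWm : Measurable W := measurable_pi_lambda _ fun i => hV i
  have hI : IndepFun (Z j) W P := by
    have h1 := hind.indepFun_finset {j} s (by simpa using hj) hV
    exact h1.comp (φ := fun v : ({j} : Finset ℕ) → (Fin (d + 1) → ℝ) × Fin (d + 1) =>
      (v ⟨j, by simp⟩).1) (ψ := id) (by fun_prop) measurable_id
  have hsub : ∀ z ω, labelError η m k s z (fun i => (Z i ω, Y i ω)) =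
      labelError η m k Finset.univ z (W ω) := fun z ω => by
    simp only [labelError, hW]
    rw [Finset.sum_coe_sort s fun i => dirichletKernel η z (Z i ω),
      Finset.sum_coe_sort s fun i => dirichletKernel η z (Z i ω) * oneHot (Y i ω) k]
  simp_rw [hsub]
  have hGm := measurable_labelError (h := η) (k := k) hm (Finset.univ : Finset s)
  have hmap := hI.map_prod_eq_prod_map_map (hZ j).aemeasurable hWm.aemeasurable
  have hpair : Measurable fun ω => (Z j ω, W ω) := (hZ j).prodMk hWm
  have hint : Integrable (fun q : (Fin (d + 1) → ℝ) × (s → (Fin (d + 1) → ℝ) × Fin (d + 1)) =>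
      labelError η m k Finset.univ q.1 q.2) ((P.map (Z j)).prod (P.map W)) := by
    rw [← hmap, integrable_map_measure hGm.aestronglyMeasurable hpair.aemeasurable]
    refine Integrable.of_bound (hGm.comp hpair).aestronglyMeasurable 1 (ae_of_all _ fun ω => ?_)
    rw [Real.norm_eq_abs, Function.comp, abs_of_nonneg (labelError_nonneg _ _ _)]
    exact labelError_le_one hη hm01 _ (hZs j ω) (W ω) fun i => hZs i ω
  have h1 : ∫ ω, labelError η m k Finset.univ (Z j ω) (W ω) ∂P =
      ∫ q, labelError η m k Finset.univ q.1 q.2 ∂((P.map (Z j)).prod (P.map W)) := by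
    rw [← hmap, integral_map hpair.aemeasurable hGm.aestronglyMeasurable]
  have := Measure.isProbabilityMeasure_map (μ := P) (hZ j).aemeasurable
  have := Measure.isProbabilityMeasure_map (μ := P) hWm.aemeasurable
  rw [h1, integral_prod _ hint, hlaw j]
  refine integral_congr_ae (ae_of_all _ fun z => ?_)
  simp only
  exact integral_map hWm.aemeasurable (f := labelError η m k Finset.univ z)
    (hGm.comp measurable_prodMk_left).aestronglyMeasurable

/-- Since `j` is outside its own sample, each mean error is an integral over `ν` of errors at fixed
points. These are bounded by `1` on the open simplex, so pointwise convergence suffices. -/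
theorem tendsto_average_integral_labelError (hZ : ∀ i, Measurable (Z i))
    (hY : ∀ i, Measurable (Y i)) (hZs : ∀ i ω, Z i ω ∈ stdSimplex ℝ (Fin (d + 1)))
    (hind : iIndepFun (fun i ω => (Z i ω, Y i ω)) P)
    (hlaw : ∀ i, P.map (Z i) = ν) (hρ : LipschitzOnWith L ρ (openSimplex d))
    (hν : ν = (simplexVolume d).withDensity (fun s => (ρ s : ℝ≥0∞)))
    (hm : Measurable m) (hm01 : ∀ w, m w ∈ Set.Icc (0 : ℝ) 1)
    (hmk : ∀ i, ∀ u : (Fin (d + 1) → ℝ) → ℝ, Measurable u → (∃ B, ∀ ω, |u (Z i ω)| ≤ B) →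
      ∫ ω, u (Z i ω) * oneHot (Y i ω) k ∂P = ∫ ω, u (Z i ω) * m (Z i ω) ∂P)
    (hpos : ∀ n, 0 < h n) (hzero : Tendsto h atTop (𝓝 0))
    (hrate : Tendsto (fun n : ℕ => (n : ℝ) * √(h n) ^ d) atTop atTop) :
    Tendsto (fun n : ℕ => (1 / (n : ℝ)) * ∑ j ∈ Finset.range n,
      ∫ ω, labelError (h n) m k ((Finset.range n).erase j) (Z j ω) (fun i => (Z i ω, Y i ω)) ∂P)
      atTop (𝓝 0) := by
  have hprob : IsProbabilityMeasure ν :=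
    hlaw 0 ▸ Measure.isProbabilityMeasure_map (hZ 0).aemeasurable
  have hV : Measurable fun ω => fun i => (Z i ω, Y i ω) :=
    measurable_pi_lambda _ fun i => (hZ i).prodMk (hY i)
  set A : ℕ → Finset ℕ → (Fin (d + 1) → ℝ) → ℝ := fun n s z =>
    ∫ ω, labelError (h n) m k s z (fun i => (Z i ω, Y i ω)) ∂P with hA
  have hAm : ∀ n s, StronglyMeasurable (A n s) := fun n s => by
    have h1 : Measurable fun q : (Fin (d + 1) → ℝ) × Ω =>
        labelError (h n) m k s q.1 (fun i => (Z i q.2, Y i q.2)) :=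
      (measurable_labelError (h := h n) (k := k) hm s).comp
        (f := fun q : (Fin (d + 1) → ℝ) × Ω => (q.1, fun i => (Z i q.2, Y i q.2)))
        (measurable_fst.prodMk (hV.comp measurable_snd))
    exact h1.stronglyMeasurable.integral_prod_right'
  have hmem : ∀ᵐ w ∂ν, w ∈ openSimplex d :=
    hν ▸ (ae_withDensity_mem_openSimplex hρ).mono fun _ h => h.1
  have hA0 : ∀ n s z, 0 ≤ A n s z := fun n s z => integral_nonneg fun ω => labelError_nonneg _ _ _
  have hA1 : ∀ n s, ∀ z ∈ openSimplex d, A n s z ≤ 1 := fun n s z hz => by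
    have h1 : A n s z ≤ ∫ _ : Ω, (1 : ℝ) ∂P :=
      integral_mono_of_nonneg (ae_of_all _ fun ω => labelError_nonneg _ _ _)
        (integrable_const _) (ae_of_all _ fun ω => labelError_le_one (hpos n) hm01 s
          (openSimplex_subset_stdSimplex hz) (fun i => (Z i ω, Y i ω)) fun i => hZs i ω)
    simpa using h1
  have hAint : ∀ n s, Integrable (A n s) ν := fun n s => by
    refine Integrable.of_bound (hAm n s).aestronglyMeasurable 1 (hmem.mono fun z hz => ?_)
    rw [Real.norm_eq_abs, abs_of_nonneg (hA0 n s z)]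
    exact hA1 n s z hz
  have havg : ∀ (n : ℕ) (F : ℕ → ℝ) (c : ℝ), 0 ≤ c → (∀ j ∈ Finset.range n, F j ≤ c) →
      (1 / (n : ℝ)) * ∑ j ∈ Finset.range n, F j ≤ c := fun n F c hc hF => by
    have h1 := Finset.sum_le_card_nsmul _ _ _ hF
    rw [Finset.card_range, nsmul_eq_mul] at h1
    rcases Nat.eq_zero_or_pos n with rfl | hn
    · simpa using hc
    · have hn' : (0 : ℝ) < n := by exact_mod_cast hn
      rw [one_div, inv_mul_le_iff₀ hn']
      exact h1
  have hav0 : ∀ (n : ℕ) z, 0 ≤ (1 / (n : ℝ)) * ∑ j ∈ Finset.range n,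
      A n ((Finset.range n).erase j) z := fun n z =>
    mul_nonneg (by positivity) (Finset.sum_nonneg fun j _ => hA0 _ _ _)
  have heq : ∀ n : ℕ, (1 / (n : ℝ)) * ∑ j ∈ Finset.range n,
      ∫ ω, labelError (h n) m k ((Finset.range n).erase j) (Z j ω) (fun i => (Z i ω, Y i ω)) ∂P =
      ∫ z, (1 / (n : ℝ)) * ∑ j ∈ Finset.range n, A n ((Finset.range n).erase j) z ∂ν := fun n => by
    rw [integral_const_mul, integral_finsetSum _ fun j _ => hAint _ _]
    congr 1
    exact Finset.sum_congr rfl fun j _ => integral_labelError_eq hZ hY hZs hind hlaw hm hm01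
      (hpos n) (Finset.notMem_erase j _)
  simp_rw [heq]
  rw [← integral_zero (Fin (d + 1) → ℝ) ℝ (μ := ν)]
  refine tendsto_integral_of_dominated_convergence (fun _ => 1) (fun n => ?_)
    (integrable_const _) (fun n => ?_) ?_
  · exact ((Finset.measurable_sum _ fun j _ => (hAm _ _).measurable).const_mul _).aestronglyMeasurable
  · filter_upwards [hmem] with z hz
    rw [Real.norm_eq_abs, abs_of_nonneg (hav0 n z)]
    exact havg n _ 1 zero_le_one fun j _ => hA1 _ _ z hz
  · filter_upwards [ae_eventually_integral_labelError_le hZ hY hZs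
      (fun i j hij => hind.indepFun hij) hlaw hρ hν hm hm01 hmk hpos hzero hrate] with z hz
    rw [Metric.tendsto_atTop']
    intro ε hε
    -- The threshold is uniform over index sets of cardinality `n - 1`, hence over all `j < n` at
    -- once.
    obtain ⟨n₀, hn₀⟩ := eventually_atTop.1 (hz (ε / 2) (half_pos hε))
    refine ⟨n₀, fun n hn => ?_⟩
    rw [Real.dist_0_eq_abs, abs_of_nonneg (hav0 n z)]
    refine (havg n _ (ε / 2) (half_pos hε).le fun j hj => hn₀ n (le_of_lt hn) _ ?_).trans_lt
      (half_lt_self hε)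
    rw [Finset.card_erase_add_one hj, Finset.card_range]

end sample

/-! ### Lipschitz dependence of the calibration gap on the estimate. -/

theorem lpNormPow_eq_sum {d : ℕ} {p : ℝ} (hp : 1 ≤ p) (v : Fin (d + 1) → ℝ) :
    lpNormPow p v = ∑ k, |v k| ^ p := by
  have hp0 : 0 ≤ p := by linarith
  have h1 : (ENNReal.ofReal p).toReal = p := ENNReal.toReal_ofReal hp0
  have h2 : 0 ≤ ∑ k, |v k| ^ p := Finset.sum_nonneg fun k _ => Real.rpow_nonneg (abs_nonneg _) _
  rw [lpNormPow, PiLp.norm_eq_sum (by rw [h1]; linarith), h1]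
  simp only [Real.norm_eq_abs]
  rw [← Real.rpow_mul h2, one_div_mul_cancel (by linarith), Real.rpow_one]

/-- This is Bernoulli's inequality for `b / a`, multiplied by `a ^ p ≤ a`. -/
theorem rpow_sub_rpow_le {p a b : ℝ} (hp : 1 ≤ p) (hb : 0 ≤ b) (hba : b ≤ a) (ha : a ≤ 1) :
    a ^ p - b ^ p ≤ p * (a - b) := by
  rcases eq_or_lt_of_le (hb.trans hba) with h0 | h0
  · have : b = 0 := le_antisymm (h0 ▸ hba) hb
    simp [← h0, this]
  have h1 := one_add_mul_self_le_rpow_one_add (s := b / a - 1) (p := p)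
    (by have : 0 ≤ b / a := by positivity
        linarith) hp
  rw [add_sub_cancel, Real.div_rpow hb h0.le, le_div_iff₀ (by positivity)] at h1
  have h2 : a ^ p ≤ a := by
    simpa using Real.rpow_le_rpow_of_exponent_ge h0 ha hp
  have h3 : (1 - b / a) * a = a - b := by field_simp
  have h4 : 0 ≤ p * (1 - b / a) := by
    have : b / a ≤ 1 := div_le_one_of_le₀ hba h0.le
    exact mul_nonneg (by linarith) (by linarith)
  have h5 := mul_le_mul_of_nonneg_left h2 h4
  rw [mul_assoc p, mul_assoc p, h3] at h5
  nlinarith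

theorem abs_rpow_sub_rpow_le {p a b : ℝ} (hp : 1 ≤ p) (ha : a ∈ Set.Icc (0 : ℝ) 1)
    (hb : b ∈ Set.Icc (0 : ℝ) 1) : |a ^ p - b ^ p| ≤ p * |a - b| := by
  rcases le_total b a with h | h
  · rw [abs_of_nonneg (sub_nonneg.2 (Real.rpow_le_rpow hb.1 h (by linarith))),
      abs_of_nonneg (sub_nonneg.2 h)]
    exact rpow_sub_rpow_le hp hb.1 h ha.2
  · rw [abs_sub_comm, abs_sub_comm a,
      abs_of_nonneg (sub_nonneg.2 (Real.rpow_le_rpow ha.1 h (by linarith))),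
      abs_of_nonneg (sub_nonneg.2 h)]
    exact rpow_sub_rpow_le hp ha.1 h hb.2

theorem abs_sub_mem_Icc {a b : ℝ} (ha : a ∈ Set.Icc (0 : ℝ) 1) (hb : b ∈ Set.Icc (0 : ℝ) 1) :
    |a - b| ∈ Set.Icc (0 : ℝ) 1 := by
  refine ⟨abs_nonneg _, ?_⟩
  rw [abs_le]
  constructor <;> linarith [ha.1, ha.2, hb.1, hb.2]

/-- `‖u - z‖_p ^ p` is Lipschitz in `u` on the unit cube. -/
theorem abs_lpNormPow_sub_le {d : ℕ} {p : ℝ} (hp : 1 ≤ p) {u v z : Fin (d + 1) → ℝ}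
    (hu : ∀ k, u k ∈ Set.Icc (0 : ℝ) 1) (hv : ∀ k, v k ∈ Set.Icc (0 : ℝ) 1)
    (hz : ∀ k, z k ∈ Set.Icc (0 : ℝ) 1) :
    |lpNormPow p (u - z) - lpNormPow p (v - z)| ≤ p * ∑ k, |u k - v k| := by
  rw [lpNormPow_eq_sum hp, lpNormPow_eq_sum hp, ← Finset.sum_sub_distrib, Finset.mul_sum]
  refine (Finset.abs_sum_le_sum_abs _ _).trans (Finset.sum_le_sum fun k _ => ?_)
  refine (abs_rpow_sub_rpow_le hp (abs_sub_mem_Icc (hu k) (hz k))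
    (abs_sub_mem_Icc (hv k) (hz k))).trans ?_
  have h1 := abs_abs_sub_abs_le_abs_sub (u k - z k) (v k - z k)
  rw [sub_sub_sub_cancel_right] at h1
  exact mul_le_mul_of_nonneg_left h1 (by linarith)

section estimate

variable {d : ℕ} {h : ℝ} {n : ℕ} {z : ℕ → Fin (d + 1) → ℝ} {y : ℕ → Fin (d + 1)}

theorem looCondExpEstimate_apply (j : ℕ) (k : Fin (d + 1)) :
    looCondExpEstimate h n z y j k =
      (∑ i ∈ (Finset.range n).erase j, dirichletKernel h (z j) (z i))⁻¹ *
        ∑ i ∈ (Finset.range n).erase j, dirichletKernel h (z j) (z i) * oneHot (y i) k := by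
  simp [looCondExpEstimate]

theorem looCondExpEstimate_mem_Icc (hh : 0 < h) (hz : ∀ i, z i ∈ stdSimplex ℝ (Fin (d + 1)))
    (j : ℕ) (k : Fin (d + 1)) : looCondExpEstimate h n z y j k ∈ Set.Icc (0 : ℝ) 1 := by
  rw [looCondExpEstimate_apply]
  have hK : ∀ i, 0 ≤ dirichletKernel h (z j) (z i) := fun i =>
    dirichletKernel_nonneg hh (hz j) (hz i)
  have h1 := abs_inv_sum_mul_sum_sub_le_one (s := (Finset.range n).erase j) (fun i _ => hK i)
    (fun i _ => oneHot_mem_Icc (y i) k) (m := 0) (by simp)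
  rw [sub_zero] at h1
  refine ⟨mul_nonneg (inv_nonneg.2 (Finset.sum_nonneg fun i _ => hK i))
    (Finset.sum_nonneg fun i _ => mul_nonneg (hK i) (oneHot_mem_Icc _ k).1),
    (le_abs_self _).trans h1⟩

/-- Replacing the estimated conditional probabilities by `m` turns the estimator into an empirical
average of a fixed function, at the price of the label errors. -/
theorem abs_ceEstimator_sub_le {p : ℝ} (hp : 1 ≤ p) (hh : 0 < h)
    (hz : ∀ i, z i ∈ stdSimplex ℝ (Fin (d + 1))) {m : Fin (d + 1) → (Fin (d + 1) → ℝ) → ℝ}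
    (hm01 : ∀ k w, m k w ∈ Set.Icc (0 : ℝ) 1) :
    |ceEstimator p h n z y - (∑ j ∈ Finset.range n, lpNormPow p ((fun k => m k (z j)) - z j)) / n| ≤
      p * ∑ k, (1 / (n : ℝ)) * ∑ j ∈ Finset.range n,
        labelError h (m k) k ((Finset.range n).erase j) (z j) (fun i => (z i, y i)) := by
  simp only [ceEstimator, one_div]
  rw [div_eq_inv_mul, ← mul_sub, ← Finset.sum_sub_distrib, abs_mul,
    abs_of_nonneg (by positivity), ← Finset.mul_sum, mul_left_comm, Finset.sum_comm,
    Finset.mul_sum (Finset.range n) _ p]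
  gcongr
  refine (Finset.abs_sum_le_sum_abs _ _).trans (Finset.sum_le_sum fun j _ => ?_)
  refine (abs_lpNormPow_sub_le hp (looCondExpEstimate_mem_Icc hh hz j) (fun k => hm01 k (z j))
    (mem_Icc_of_mem_stdSimplex (hz j))).trans (le_of_eq ?_)
  congr 1
  exact Finset.sum_congr rfl fun k _ => by rw [looCondExpEstimate_apply]; rfl

end estimate

/-! ### Convergence in probability and the regression function. -/

/-- Split `ε` in halves and apply Markov's inequality to `D n`. -/
theorem tendstoInMeasure_of_abs_sub_le {Ω : Type*} [MeasurableSpace Ω] {P : Measure Ω}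
    [IsProbabilityMeasure P] {T S D : ℕ → Ω → ℝ} {c : ℝ}
    (hS : TendstoInMeasure P S atTop fun _ => c) (hTD : ∀ n ω, |T n ω - S n ω| ≤ D n ω)
    (hint : ∀ n, Integrable (D n) P) (hD : Tendsto (fun n => ∫ ω, D n ω ∂P) atTop (𝓝 0)) :
    TendstoInMeasure P T atTop fun _ => c := by
  rw [tendstoInMeasure_iff_measureReal_dist] at hS ⊢
  intro ε hε
  have h1 := hS (ε / 2) (half_pos hε)
  have h2 := h1.add (hD.const_mul (2 / ε))
  rw [mul_zero, add_zero] at h2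
  refine squeeze_zero (fun n => measureReal_nonneg) (fun n => ?_) h2
  have hm := mul_meas_ge_le_integral_of_nonneg
    (ae_of_all P fun ω => (abs_nonneg _).trans (hTD n ω)) (hint n) (ε / 2)
  have h3 : P.real {ω | ε / 2 ≤ D n ω} ≤ 2 / ε * ∫ ω, D n ω ∂P := by
    rw [div_mul_eq_mul_div, le_div_iff₀ hε]
    linarith
  have hsub : {ω | ε ≤ dist (T n ω) c} ⊆
      {ω | ε / 2 ≤ dist (S n ω) c} ∪ {ω | ε / 2 ≤ D n ω} := fun ω hω => by
    simp only [Set.mem_union, Set.mem_ofPred_eq] at hω ⊢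
    by_contra! hcon
    have h4 := dist_triangle (T n ω) (S n ω) c
    have h5 : dist (T n ω) (S n ω) ≤ D n ω := hTD n ω
    linarith [hcon.1, hcon.2]
  calc P.real {ω | ε ≤ dist (T n ω) c}
      ≤ P.real ({ω | ε / 2 ≤ dist (S n ω) c} ∪ {ω | ε / 2 ≤ D n ω}) := measureReal_mono hsub
    _ ≤ _ := (measureReal_union_le _ _).trans (by gcongr)

/-- The conditional expectation of the one-hot encoded label given the prediction, as a function of
the prediction. -/
theorem exists_condExp_oneHot_eq {Ω : Type*} [mΩ : MeasurableSpace Ω] (P : Measure Ω)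
    [IsProbabilityMeasure P] {d : ℕ} {z : Ω → Fin (d + 1) → ℝ} {y : Ω → Fin (d + 1)}
    (hz : Measurable z) (hy : Measurable y) :
    ∃ m : Fin (d + 1) → (Fin (d + 1) → ℝ) → ℝ, (∀ k, Measurable (m k)) ∧
      (∀ k w, m k w ∈ Set.Icc (0 : ℝ) 1) ∧
      (∀ᵐ ω ∂P, (P[fun ω' => oneHot (y ω') | MeasurableSpace.comap z inferInstance]) ω =
        fun k => m k (z ω)) ∧
      ∀ k, ∀ u : (Fin (d + 1) → ℝ) → ℝ, Measurable u → (∃ B, ∀ ω, |u (z ω)| ≤ B) →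
        ∫ ω, u (z ω) * oneHot (y ω) k ∂P = ∫ ω, u (z ω) * m k (z ω) ∂P := by
  have hle : MeasurableSpace.comap z inferInstance ≤ mΩ := hz.comap_le
  have hmo : ∀ k, Measurable fun ω => (oneHot (y ω) k : ℝ) := fun k =>
    (measurable_of_countable fun y : Fin (d + 1) => (oneHot y k : ℝ)).comp hy
  have hint : ∀ k, Integrable (fun ω => (oneHot (y ω) k : ℝ)) P := fun k => by
    refine Integrable.of_bound (hmo k).aestronglyMeasurable 1 (ae_of_all _ fun ω => ?_)
    rw [Real.norm_eq_abs, abs_of_nonneg (oneHot_mem_Icc _ k).1]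
    exact (oneHot_mem_Icc _ k).2
  have hintv : Integrable (fun ω => oneHot (y ω)) P := Integrable.of_eval hint
  -- The Doob-Dynkin factorisation writes the conditional expectation as a function of the
  -- prediction.
  obtain ⟨G, hGm, hG⟩ := (stronglyMeasurable_condExp
    (m := MeasurableSpace.comap z inferInstance) (μ := P) (f := fun ω => oneHot (y ω))).exists_eq_measurable_comp
  have hcoord : ∀ k, (fun ω => G (z ω) k) =ᵐ[P]
      P[fun ω => (oneHot (y ω) k : ℝ) | MeasurableSpace.comap z inferInstance] := fun k => by
    have h1 := (ContinuousLinearMap.proj (R := ℝ) (φ := fun _ : Fin (d + 1) => ℝ) k).comp_condExp_comm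
      (m := MeasurableSpace.comap z inferInstance) hintv
    rw [hG] at h1
    exact h1
  have hG0 : ∀ k, ∀ᵐ ω ∂P, 0 ≤ G (z ω) k := fun k => by
    have h1 : 0 ≤ᵐ[P] P[fun ω => (oneHot (y ω) k : ℝ) | MeasurableSpace.comap z inferInstance] :=
      condExp_nonneg (ae_of_all _ fun ω => (oneHot_mem_Icc _ k).1)
    filter_upwards [h1, hcoord k] with ω h2 h3
    rw [h3]
    exact h2
  have hG1 : ∀ k, ∀ᵐ ω ∂P, G (z ω) k ≤ 1 := fun k => by
    have h1 := condExp_mono (m := MeasurableSpace.comap z inferInstance) (hint k)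
      (integrable_const (μ := P) (1 : ℝ))
      (ae_of_all _ fun ω => (oneHot_mem_Icc _ k).2)
    rw [condExp_const hle] at h1
    filter_upwards [h1, hcoord k] with ω h2 h3
    rw [h3]
    exact h2
  have hGk : ∀ k, Measurable fun w => G w k := fun k => (measurable_pi_apply k).comp hGm.measurable
  -- The coordinates lie in `[0, 1]` only almost surely; clamping makes this hold everywhere without
  -- changing the version.
  have hclamp : ∀ k, ∀ᵐ ω ∂P, G (z ω) k = max 0 (min 1 (G (z ω) k)) := fun k => by
    filter_upwards [hG0 k, hG1 k] with ω h0 h1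
    rw [min_eq_right h1, max_eq_right h0]
  refine ⟨fun k w => max 0 (min 1 (G w k)),
    fun k => measurable_const.max (measurable_const.min (hGk k)),
    fun k w => ⟨le_max_left _ _, max_le zero_le_one (min_le_left _ _)⟩, ?_, ?_⟩
  · filter_upwards [ae_all_iff.2 hclamp] with ω hω
    rw [hG]
    exact funext hω
  · rintro k u hu ⟨B, hB⟩
    have huz : StronglyMeasurable[MeasurableSpace.comap z inferInstance] fun ω => u (z ω) :=
      (hu.comp (comap_measurable z)).stronglyMeasurable
    have h1 := condExp_stronglyMeasurable_mul_of_bound hle huz (hint k) B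
      (ae_of_all _ fun ω => by rw [Real.norm_eq_abs]; exact hB ω)
    have h2 := integral_condExp (μ := P) hle (f := (fun ω => u (z ω)) * fun ω => oneHot (y ω) k)
    rw [integral_congr_ae h1] at h2
    refine h2.symm.trans (integral_congr_ae ?_)
    filter_upwards [hcoord k, hclamp k] with ω h3 h4
    rw [Pi.mul_apply, ← h3, ← h4]

/-! ### Consistency of the estimator. -/

section consistency

variable {Ω : Type*} [MeasurableSpace Ω] {P : Measure Ω} [IsProbabilityMeasure P] {d : ℕ}

/-- The strong law handles the average with the true `m`, and the label errors vanish in mean. -/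
theorem tendstoInMeasure_ceEstimator {Z : ℕ → Ω → Fin (d + 1) → ℝ} {Y : ℕ → Ω → Fin (d + 1)}
    {ν : Measure (Fin (d + 1) → ℝ)} {ρ : (Fin (d + 1) → ℝ) → ℝ≥0} {L : ℝ≥0}
    {m : Fin (d + 1) → (Fin (d + 1) → ℝ) → ℝ} {h : ℕ → ℝ} {p : ℝ} (hp : 1 ≤ p)
    (hZ : ∀ i, Measurable (Z i))
    (hY : ∀ i, Measurable (Y i)) (hZs : ∀ i ω, Z i ω ∈ stdSimplex ℝ (Fin (d + 1)))
    (hind : iIndepFun (fun i ω => (Z i ω, Y i ω)) P)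
    (hlaw : ∀ i, P.map (Z i) = ν) (hρ : LipschitzOnWith L ρ (openSimplex d))
    (hν : ν = (simplexVolume d).withDensity (fun s => (ρ s : ℝ≥0∞)))
    (hm : ∀ k, Measurable (m k)) (hm01 : ∀ k w, m k w ∈ Set.Icc (0 : ℝ) 1)
    (hmk : ∀ k i, ∀ u : (Fin (d + 1) → ℝ) → ℝ, Measurable u → (∃ B, ∀ ω, |u (Z i ω)| ≤ B) →
      ∫ ω, u (Z i ω) * oneHot (Y i ω) k ∂P = ∫ ω, u (Z i ω) * m k (Z i ω) ∂P)
    (hpos : ∀ n, 0 < h n) (hzero : Tendsto h atTop (𝓝 0))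
    (hrate : Tendsto (fun n : ℕ => (n : ℝ) * √(h n) ^ d) atTop atTop) :
    TendstoInMeasure P
      (fun n ω => ceEstimator p (h n) n (fun i => Z i ω) (fun i => Y i ω)) atTop
      (fun _ => ∫ w, lpNormPow p ((fun k => m k w) - w) ∂ν) := by
  obtain ⟨φ, hφ⟩ : ∃ φ : (Fin (d + 1) → ℝ) → ℝ, ∀ w, lpNormPow p ((fun k => m k w) - w) = φ w :=
    ⟨_, fun _ => rfl⟩
  have hφeq : ∀ w, φ w = ∑ k, |m k w - w k| ^ p := fun w => hφ w ▸ lpNormPow_eq_sum hp _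
  simp only [hφ]
  have hφm : Measurable φ := by
    rw [funext hφeq]
    exact Finset.measurable_sum _ fun k _ =>
      (((hm k).sub (measurable_pi_apply k)).abs).pow_const p
  have hφb : ∀ i ω, ‖φ (Z i ω)‖ ≤ d + 1 := fun i ω => by
    rw [hφeq, Real.norm_eq_abs, abs_of_nonneg
      (Finset.sum_nonneg fun k _ => Real.rpow_nonneg (abs_nonneg _) _)]
    have h1 : ∀ k ∈ (Finset.univ : Finset (Fin (d + 1))), |m k (Z i ω) - Z i ω k| ^ p ≤ 1 :=
      fun k _ => by
        have h2 := abs_sub_mem_Icc (hm01 k (Z i ω)) (mem_Icc_of_mem_stdSimplex (hZs i ω) k)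
        exact Real.rpow_le_one h2.1 h2.2 (by linarith)
    have h2 := Finset.sum_le_card_nsmul _ _ _ h1
    simpa using h2
  have hφi : ∀ i, Integrable (fun ω => φ (Z i ω)) P := fun i =>
    Integrable.of_bound (hφm.comp (hZ i)).aestronglyMeasurable _ (ae_of_all _ (hφb i))
  have hLLN := strong_law_ae_real (μ := P) (fun i ω => φ (Z i ω)) (hφi 0)
    (fun i j hij => (hind.indepFun hij).comp 
      (φ := fun v : (Fin (d + 1) → ℝ) × Fin (d + 1) => φ v.1)
      (ψ := fun v : (Fin (d + 1) → ℝ) × Fin (d + 1) => φ v.1)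
      (hφm.comp measurable_fst) (hφm.comp measurable_fst))
    (fun i => by
      have : IdentDistrib (Z i) (Z 0) P P :=
        ⟨(hZ i).aemeasurable, (hZ 0).aemeasurable, by rw [hlaw, hlaw]⟩
      exact this.comp hφm)
  have hmean : ∫ ω, φ (Z 0 ω) ∂P = ∫ w, φ w ∂ν := by
    rw [← hlaw 0, integral_map (hZ 0).aemeasurable hφm.aestronglyMeasurable]
  rw [hmean] at hLLN
  have hS : TendstoInMeasure P (fun (n : ℕ) ω => (∑ i ∈ Finset.range n, φ (Z i ω)) / n) atTop
      (fun _ => ∫ w, φ w ∂ν) := by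
    refine tendstoInMeasure_of_tendsto_ae (fun n => ?_) hLLN
    exact ((Finset.measurable_sum _ fun i _ => hφm.comp (hZ i)).div_const _).aestronglyMeasurable
  have hV : Measurable fun ω => fun i => (Z i ω, Y i ω) :=
    measurable_pi_lambda _ fun i => (hZ i).prodMk (hY i)
  have hLm : ∀ n k s j, Measurable fun ω =>
      labelError (h n) (m k) k s (Z j ω) (fun i => (Z i ω, Y i ω)) := fun n k s j =>
    (measurable_labelError (h := h n) (k := k) (hm k) s).comp
      (f := fun ω => (Z j ω, fun i => (Z i ω, Y i ω))) ((hZ j).prodMk hV)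
  have hLi : ∀ n k s j, Integrable (fun ω =>
      labelError (h n) (m k) k s (Z j ω) (fun i => (Z i ω, Y i ω))) P := fun n k s j => by
    refine Integrable.of_bound (hLm n k s j).aestronglyMeasurable 1 (ae_of_all _ fun ω => ?_)
    rw [Real.norm_eq_abs, abs_of_nonneg (labelError_nonneg _ _ _)]
    exact labelError_le_one (hpos n) (hm01 k) s (hZs j ω) (fun i => (Z i ω, Y i ω))
      fun i => hZs i ω
  have hDi : ∀ (n : ℕ) (k : Fin (d + 1)), Integrable (fun ω => (1 / (n : ℝ)) * ∑ j ∈ Finset.range n,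
      labelError (h n) (m k) k ((Finset.range n).erase j) (Z j ω) (fun i => (Z i ω, Y i ω))) P :=
    fun n k => (integrable_finsetSum _ fun j _ => hLi _ _ _ _).const_mul _
  have hle := fun (n : ℕ) ω => abs_ceEstimator_sub_le (n := n) (y := fun i => Y i ω) hp (hpos n)
    (fun i => hZs i ω) hm01
  simp only [hφ] at hle
  refine tendstoInMeasure_of_abs_sub_le hS hle
    (fun n => (integrable_finsetSum _ fun k _ => hDi n k).const_mul p) ?_
  have heq : ∀ n : ℕ, ∫ ω, p * ∑ k, (1 / (n : ℝ)) * ∑ j ∈ Finset.range n,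
      labelError (h n) (m k) k ((Finset.range n).erase j) (Z j ω) (fun i => (Z i ω, Y i ω)) ∂P =
      p * ∑ k, (1 / (n : ℝ)) * ∑ j ∈ Finset.range n, ∫ ω,
      labelError (h n) (m k) k ((Finset.range n).erase j) (Z j ω) (fun i => (Z i ω, Y i ω)) ∂P := by
    intro n
    rw [integral_const_mul, integral_finsetSum _ fun k _ => hDi n k]
    congr 1
    refine Finset.sum_congr rfl fun k _ => ?_
    rw [integral_const_mul, integral_finsetSum _ fun j _ => hLi _ _ _ _]
  simp_rw [heq]
  have h1 := (tendsto_finsetSum Finset.univ fun k _ => tendsto_average_integral_labelError hZ hY hZs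
    hind hlaw hρ hν (hm k) (hm01 k) (hmk k) hpos hzero hrate).const_mul p
  simpa using h1

end consistency

theorem proposition4 {Ω : Type*} [MeasurableSpace Ω] (P : Measure Ω) [IsProbabilityMeasure P]
    {𝒳 : Type*} [MeasurableSpace 𝒳] (d : ℕ)
    -- the model, with values in the simplex with `d + 1` vertices (`d + 1` classes)
    (f : 𝒳 → Fin (d + 1) → ℝ) (hf : Measurable f) (hf_mem : ∀ u, f u ∈ stdSimplex ℝ (Fin (d + 1)))
    -- the input and its label
    (x : Ω → 𝒳) (y : Ω → Fin (d + 1)) (hx : Measurable x) (hy : Measurable y)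
    -- the sample: independent copies of `(x, y)`
    (X : ℕ → Ω → 𝒳) (Y : ℕ → Ω → Fin (d + 1))
    (hindep : iIndepFun (fun i ω => (X i ω, Y i ω)) P)
    (hident : ∀ i, IdentDistrib (fun ω => (X i ω, Y i ω)) (fun ω => (x ω, y ω)) P P)
    -- `f(x)` has a density that is Lipschitz on the interior of the simplex
    (ρ : (Fin (d + 1) → ℝ) → ℝ≥0) (L : ℝ≥0) (hρ : LipschitzOnWith L ρ (openSimplex d))
    (hdens : P.map (fun ω => f (x ω)) = (simplexVolume d).withDensity (fun s => (ρ s : ℝ≥0∞)))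
    -- the bandwidths
    (h : ℕ → ℝ) (hpos : ∀ n, 0 < h n) (hzero : Tendsto h atTop (𝓝 0))
    (hrate : Tendsto (fun n : ℕ => (n : ℝ) * h n ^ ((d : ℝ) / 2)) atTop atTop)
    (p : ℝ) (hp : 1 ≤ p) :
    Integrable (calibrationGap P p (fun ω => f (x ω)) y) P ∧
      TendstoInMeasure P
        (fun (n : ℕ) (ω : Ω) => ceEstimator p (h n) n (fun i => f (X i ω)) (fun i => Y i ω))
        atTop
        (fun _ => ∫ ω, calibrationGap P p (fun ω' => f (x ω')) y ω ∂P) := 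
by
  have hz : Measurable fun ω => f (x ω) := hf.comp hx
  obtain ⟨m, hm, hm01, hcond, hmk⟩ := exists_condExp_oneHot_eq P hz hy
  set ν := P.map fun ω => f (x ω) with hν
  set φ : (Fin (d + 1) → ℝ) → ℝ := fun w => lpNormPow p ((fun k => m k w) - w) with hφ
  have hφeq : ∀ w, φ w = ∑ k, |m k w - w k| ^ p := fun w => lpNormPow_eq_sum hp _
  have hφm : Measurable φ := by
    rw [funext hφeq]
    exact Finset.measurable_sum _ fun k _ =>
      (((hm k).sub (measurable_pi_apply k)).abs).pow_const p
  have hgap : calibrationGap P p (fun ω => f (x ω)) y =ᵐ[P] fun ω => φ (f (x ω)) := by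
    filter_upwards [hcond] with ω hω
    rw [calibrationGap, hω]
  have hint : Integrable (fun ω => φ (f (x ω))) P := by
    refine Integrable.of_bound (hφm.comp hz).aestronglyMeasurable (d + 1) (ae_of_all _ fun ω => ?_)
    rw [hφeq, Real.norm_eq_abs, abs_of_nonneg
      (Finset.sum_nonneg fun k _ => Real.rpow_nonneg (abs_nonneg _) _)]
    have h1 : ∀ k ∈ (Finset.univ : Finset (Fin (d + 1))), |m k (f (x ω)) - f (x ω) k| ^ p ≤ 1 :=
      fun k _ => by
        have h2 := abs_sub_mem_Icc (hm01 k (f (x ω))) (mem_Icc_of_mem_stdSimplex (hf_mem (x ω)) k)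
        exact Real.rpow_le_one h2.1 h2.2 (by linarith)
    have h2 := Finset.sum_le_card_nsmul _ _ _ h1
    simpa using h2
  refine ⟨hint.congr hgap.symm, ?_⟩
  have hmean : ∫ ω, calibrationGap P p (fun ω' => f (x ω')) y ω ∂P = ∫ w, φ w ∂ν := by
    rw [integral_congr_ae hgap, hν, integral_map hz.aemeasurable hφm.aestronglyMeasurable]
  rw [hmean]
  have hXm : ∀ i, AEMeasurable (X i) P := fun i => (hident i).aemeasurable_fst.fst
  have hYm : ∀ i, AEMeasurable (Y i) P := fun i => (hident i).aemeasurable_fst.snd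
  -- Identical distribution gives only almost-everywhere measurability of the sample. Modifying `X
  -- i` before applying `f` keeps the predictions in the simplex at every `ω`.
  set Z' : ℕ → Ω → Fin (d + 1) → ℝ := fun i ω => f ((hXm i).mk (X i) ω) with hZ'
  set Y' : ℕ → Ω → Fin (d + 1) := fun i => (hYm i).mk (Y i) with hY'
  have hZm : ∀ i, Measurable (Z' i) := fun i => hf.comp (hXm i).measurable_mk
  have hYm' : ∀ i, Measurable (Y' i) := fun i => (hYm i).measurable_mk
  have hae : ∀ i, (fun ω => (f (X i ω), Y i ω)) =ᵐ[P] fun ω => (Z' i ω, Y' i ω) := fun i => by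
    filter_upwards [(hXm i).ae_eq_mk, (hYm i).ae_eq_mk] with ω h1 h2
    rw [hZ', hY', h2]
    simp only
    rw [← h1, ← h2]
  have hpair : Measurable fun q : 𝒳 × Fin (d + 1) => (f q.1, q.2) := by fun_prop
  have hind : iIndepFun (fun i ω => (Z' i ω, Y' i ω)) P :=
    (hindep.comp (fun _ q => (f q.1, q.2)) fun _ => hpair).congr hae
  have hid : ∀ i, IdentDistrib (fun ω => (Z' i ω, Y' i ω)) (fun ω => (f (x ω), y ω)) P P :=
    fun i => (IdentDistrib.of_ae_eq ((hZm i).prodMk (hYm' i)).aemeasurable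
      (hae i).symm).trans ((hident i).comp hpair)
  have hlaw : ∀ i, P.map (Z' i) = ν := fun i => ((hid i).comp measurable_fst).map_eq
  have hmk' : ∀ k i, ∀ u : (Fin (d + 1) → ℝ) → ℝ, Measurable u →
      (∃ B, ∀ ω, |u (Z' i ω)| ≤ B) →
      ∫ ω, u (Z' i ω) * oneHot (Y' i ω) k ∂P = ∫ ω, u (Z' i ω) * m k (Z' i ω) ∂P := by
    rintro k i u hu ⟨B, hB⟩
    -- The function `u` is bounded only along `Z' i`, whereas the identity to be transferred needs a
    -- bound along `f ∘ x`; truncation gives a global one.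
    set u' : (Fin (d + 1) → ℝ) → ℝ := fun w => max (-B) (min B (u w)) with hu'
    have hu'm : Measurable u' := measurable_const.max (measurable_const.min hu)
    have huu : ∀ ω, u (Z' i ω) = u' (Z' i ω) := fun ω => by
      have h1 := abs_le.1 (hB ω)
      simp only [hu']
      rw [min_eq_right h1.2, max_eq_right h1.1]
    have hu'b : ∀ w, |u' w| ≤ |B| := fun w => by
      refine abs_le.2 ⟨?_, max_le (neg_le_abs B) ((min_le_left _ _).trans (le_abs_self B))⟩
      exact (neg_le_neg (le_abs_self B)).trans (le_max_left _ _)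
    simp only [huu]
    have hmo : Measurable fun q : (Fin (d + 1) → ℝ) × Fin (d + 1) => (oneHot q.2 k : ℝ) :=
      (measurable_of_countable fun y : Fin (d + 1) => (oneHot y k : ℝ)).comp measurable_snd
    have e1 := ((hid i).comp ((hu'm.comp measurable_fst).mul hmo)).integral_eq
    have e2 := ((hid i).comp ((hu'm.comp measurable_fst).mul
      ((hm k).comp measurable_fst))).integral_eq
    exact e1.trans ((hmk k u' hu'm ⟨|B|, fun ω => hu'b _⟩).trans e2.symm)
  have hrate' : Tendsto (fun n : ℕ => (n : ℝ) * √(h n) ^ d) atTop atTop := by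
    refine hrate.congr fun n => ?_
    rw [Real.sqrt_eq_rpow, ← Real.rpow_natCast, ← Real.rpow_mul (hpos n).le]
    congr 2
    ring
  refine (tendstoInMeasure_ceEstimator hp hZm hYm' (fun i ω => hf_mem _) hind hlaw hρ hdens hm hm01
    hmk' hpos hzero hrate').congr_left fun n => ?_
  filter_upwards [ae_all_iff.2 hae] with ω hω
  have h1 : (fun i => f (X i ω)) = fun i => Z' i ω := funext fun i => congrArg Prod.fst (hω i)
  have h2 : (fun i => Y i ω) = fun i => Y' i ω := funext fun i => congrArg Prod.snd (hω i)
  rw [h1, h2]
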